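/- Let $\beta>1$. Define $r_0=1$, $c_{i+1}=\lceil\beta r_i\rceil-1$, $r_{i+1}=\beta r_i-c_{i+1}$ for $i\ge 0$, so that $1=\sum_{i\ge1}c_i\beta^{-i}$; the sequence $c=(c_1,c_2,\dots)$ does not end with zeros only. Let $\mathtt A=\{0,\dots,\lceil\beta\rceil-1\}$ with the discrete topology, and let $$\Sigma^\beta=\{x\in\mathtt A^{\mathbb Z}:\ (x_k,x_{k+1},\dots)\preceq c\ \text{ for all } k\in\mathbb Z\}$$ ($\preceq$ the lexicographic order) be the two-sided $\beta$-shift, with the product topology, and $T$ the left shift on it. For a prefix $u=c_1\cdots c_\ell$ of $c$ with $\ell\ge1$ let $z^\beta(u)=p$ if $c_{\ell+1}=\dots=c_{\ell+p}=0$ and $c_{\ell+p+1}>0$; let $z^\beta(\epsilon)=0$ for the empty word $\epsilon$; and let $\bar z^\beta(n)=\max\{z^\beta(u): u \text{ a prefix of } c \text{ of length at most } n\}$. For $\bar f\in C(\mathtt A^{\mathbb Z})$ let $\delta_i(\bar f)=\sup\{|\bar f(x)-\bar f(y)|: x_k=y_k \text{ for all } k\neq i\}$. A function $f\in C(\Sigma^\beta)$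 has bounded total oscillations if $\inf\{\sum_{i\in\mathbb Z}\delta_i(\bar f)\}<\infty$, the infimum being over the continuous extensions $\bar f$ of $f$ to $\mathtt A^{\mathbb Z}$. The pressure of $\varphi\in C(\Sigma^\beta)$ is $$p(\varphi)=\lim_{n\to\infty}\frac1{2n+1}\ln\sum_{x\in E^n}\exp\Big(\sum_{|j|\le n}\varphi(T^jx)\Big),\qquad E^n=\{x\in\Sigma^\beta: x_j=0 \text{ for } |j|>n\}.$$ A $T$-invariant Borel probability measure $\nu$ on $\Sigma^\beta$ is an equilibrium measure for $\varphi$ if $p(\varphi)=h_T(\nu)+\int\varphi\,d\nu$, where $h_T(\nu)$ is the Kolmogorov–Sinai entropy. It is a weak Gibbs measure for $\psi\in C(\Sigma^\beta)$ if for every $\delta>0$ there is $N_\delta$ such that for all $m\ge N_\delta$ $$\sup_{x\in\Sigma^\beta}\Big|\frac1m\ln\nu([x_0\cdots x_{m-1}])-\frac1m\sum_{\ell=0}^{m-1}\psi(T^\ell x)\Big|\le\delta,$$ where $[x_0\cdots x_{m-1}]=\{y\in\Sigma^\beta: y_0\cdots y_{m-1}=x_0\cdots x_{m-1}\}$ and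 $\ln 0=-\infty$. **Theorem.** Let $\beta>1$ and let $\varphi\in C(\Sigma^\beta)$ have bounded total oscillations. (1) If $\lim_{n\to\infty}\bar z^\beta(n)/n=0$, then every equilibrium measure of $\varphi$ is a weak Gibbs measure for $\psi=\varphi-p(\varphi)$. (2) If $\limsup_{n\to\infty}\bar z^\beta(n)/n>0$, then no equilibrium measure of $\varphi$ is a weak Gibbs measure for $\psi=\varphi-p(\varphi)$. -/

import Mathlib

open Filter Topology MeasureTheory Set
open scoped ENNReal

noncomputable section

namespace BetaShift

/-! ### The β-expansion of 1 -/

/-- The remainders `r_0 = 1`, `r_{i+1} = β r_i - c_{i+1}` with `c_{i+1} = ⌈β r_i⌉ - 1`. -/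
def rem (β : ℝ) : ℕ → ℝ
  | 0 => 1
  | i + 1 => β * rem β i - ((⌈β * rem β i⌉ : ℝ) - 1)

/-- The digits of the β-expansion of `1`, indexed from `0`: `digit β i` is
`c_{i+1} = ⌈β r_i⌉ - 1` (for `β > 1` one has `β r_i > 0`, so that the natural-number
ceiling and subtraction are the usual ones). -/
def digit (β : ℝ) (i : ℕ) : ℕ := ⌈β * rem β i⌉₊ - 1

/-- For the prefix `u = c_1 ⋯ c_ℓ` of the expansion of `1`: the number `z(u)` of zeros which
immediately follow `u`, that is the least `p` with `c_{ℓ+p+1} > 0`; and `0` for the empty word. -/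
def zeroRun (β : ℝ) (ℓ : ℕ) : ℕ :=
  if ℓ = 0 then 0 else sInf {p : ℕ | 0 < digit β (ℓ + p)}

/-- `z̄(n)`, the maximum of `z(u)` over the prefixes `u` of length at most `n`. -/
def maxZeroRun (β : ℝ) (n : ℕ) : ℕ := (Finset.range (n + 1)).sup (zeroRun β)

/-! ### The shift spaces -/

/-- The alphabet `{0, …, ⌈β⌉ - 1}`. -/
abbrev Alphabet (β : ℝ) : Type := Fin ⌈β⌉₊

/-- The lexicographic order (non-strict) on sequences. -/
def LexLE (a b : ℕ → ℕ) : Prop :=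
  a = b ∨ ∃ i, (∀ j < i, a j = b j) ∧ a i < b i

/-- The one-sided β-shift: all shifted sequences are at most the expansion of `1`. -/
def oneSided (β : ℝ) : Set (ℕ → Alphabet β) :=
  {x | ∀ k : ℕ, LexLE (fun i => (x (k + i) : ℕ)) (digit β)}

/-- The two-sided β-shift `Σ^β` (the natural extension of the one-sided β-shift). -/
def twoSided (β : ℝ) : Set (ℤ → Alphabet β) :=
  {x | ∀ k : ℤ, (fun i : ℕ => x (k + i)) ∈ oneSided β}

/-- The `j`-th power `T^j` of the left shift on `Σ^β`, `(T^j x)_i = x_{i+j}`, for `j ∈ ℤ`. -/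
def shift {β : ℝ} (j : ℤ) (x : twoSided β) : twoSided β :=
  ⟨fun i => x.1 (i + j), fun k => by
    have h := x.2 (k + j)
    have e : (fun i : ℕ => x.1 (k + j + i)) = fun i : ℕ => x.1 (k + i + j) := by
      funext i
      rw [add_right_comm]
    rwa [e] at h⟩

/-- The cylinder `[x_0 ⋯ x_{m-1}]` in `Σ^β`. -/
def cylinder {β : ℝ} (m : ℕ) (x : twoSided β) : Set (twoSided β) :=
  {y | ∀ i : ℕ, i < m → y.1 i = x.1 i}

/-- `T`-invariant (Borel) probability measures on `Σ^β`. -/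
def IsInvariantProb {β : ℝ} (ν : Measure (twoSided β)) : Prop :=
  IsProbabilityMeasure ν ∧ MeasurePreserving (shift (β := β) 1) ν ν

/-! ### Functions of bounded total oscillations -/

/-- The oscillation `δ_i(g)` at the site `i` of a function on the full shift. -/
def osc {β : ℝ} (g : C(ℤ → Alphabet β, ℝ)) (i : ℤ) : ℝ≥0∞ :=
  ⨆ (x : ℤ → Alphabet β) (y : ℤ → Alphabet β) (_ : ∀ k, k ≠ i → x k = y k),
    ENNReal.ofReal |g x - g y|

/-- The total oscillation `∑_i δ_i(g)` of a continuous function on the full shift. -/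
def totalOsc {β : ℝ} (g : C(ℤ → Alphabet β, ℝ)) : ℝ≥0∞ := ∑' i : ℤ, osc g i

/-- The total oscillation of a continuous function on `Σ^β`: the infimum of the total
oscillations of its continuous extensions to the full shift. -/
def oscNorm {β : ℝ} (f : C(twoSided β, ℝ)) : ℝ≥0∞ :=
  ⨅ (g : C(ℤ → Alphabet β, ℝ)) (_ : ∀ x : twoSided β, g x.1 = f x), totalOsc g

/-- Functions of bounded total oscillations on `Σ^β`. -/
def BoundedTotalOsc {β : ℝ} (f : C(twoSided β, ℝ)) : Prop := oscNorm f < ∞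

/-! ### Pressure -/

/-- The set `E^n` of the points of `Σ^β` whose coordinates outside `[-n, n]` are `0`. Each word of
length `2n+1` of the language of `Σ^β` is the restriction to `[-n, n]` of exactly one of them. -/
def zeroExt (β : ℝ) (n : ℕ) : Set (twoSided β) :=
  {x | ∀ j : ℤ, (n : ℤ) < |j| → (x.1 j : ℕ) = 0}

theorem zeroExt_finite (β : ℝ) (n : ℕ) : (zeroExt β n).Finite := by
  refine Set.Finite.of_finite_image
    (f := fun (x : twoSided β) (j : Finset.Icc (-(n : ℤ)) n) => x.1 j.1)
    (Set.toFinite _) ?_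
  intro x hx y hy hxy
  apply Subtype.ext
  funext j
  by_cases hj : j ∈ Finset.Icc (-(n : ℤ)) n
  · exact congrFun hxy ⟨j, hj⟩
  · have hj' : (n : ℤ) < |j| := by
      by_contra h
      exact hj (Finset.mem_Icc.2 (abs_le.1 (not_lt.1 h)))
    exact Fin.ext ((hx j hj').trans (hy j hj').symm)

/-- The partition function `∑_{x ∈ E^n} exp ∑_{|j| ≤ n} φ(T^j x)`. -/
def partitionFn {β : ℝ} (φ : C(twoSided β, ℝ)) (n : ℕ) : ℝ :=
  ∑ x ∈ (zeroExt_finite β n).toFinset,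
    Real.exp (∑ j ∈ Finset.Icc (-(n : ℤ)) n, φ (shift j x))

/-- The pressure `p(φ)`, the limit of `(2n+1)⁻¹ log ∑_{x ∈ E^n} exp ∑_{|j| ≤ n} φ(T^j x)`
(a bounded sequence; the limit exists, and `limsup` is its value). -/
def pressure {β : ℝ} (φ : C(twoSided β, ℝ)) : ℝ :=
  limsup (fun n : ℕ => Real.log (partitionFn φ n) / (2 * n + 1)) atTop

/-! ### Measure-theoretic entropy and equilibrium measures -/

/-- The Shannon entropy of the join `⋁_{i<n} T^{-i} ξ`, where the finite measurable partition is
given by its labelling function `ξ : α → Fin k`. -/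
def joinEntropy {α : Type*} [MeasurableSpace α] (μ : Measure α) (T : α → α) {k : ℕ}
    (ξ : α → Fin k) (n : ℕ) : ℝ :=
  ∑ w : Fin n → Fin k, Real.negMulLog (μ.real {x | ∀ i : Fin n, ξ (T^[i] x) = w i})

/-- The Kolmogorov–Sinai entropy `h_T(μ)`: the supremum, over all finite measurable partitions, of
the entropy of `T` with respect to the partition. -/
def entropy {α : Type*} [MeasurableSpace α] (μ : Measure α) (T : α → α) : EReal :=
  ⨆ (k : ℕ) (ξ : α → Fin k) (_ : Measurable ξ),
    limsup (fun n : ℕ => ((joinEntropy μ T ξ n / n : ℝ) : EReal)) atTop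

/-- `ν` is an equilibrium measure for `φ`: an invariant probability measure such that
`p(φ) = h_T(ν) + ∫ φ dν`. -/
def IsEquilibrium {β : ℝ} (φ : C(twoSided β, ℝ)) (ν : Measure (twoSided β)) : Prop :=
  IsInvariantProb ν ∧
    (pressure φ : EReal) = entropy ν (shift (β := β) 1) + ((∫ x, φ x ∂ν : ℝ) : EReal)

/-! ### Weak Gibbs measures -/

/-- `ν` is a weak Gibbs measure for `ψ`. Since `log 0 = -∞` in the definition of the notion,
all cylinders involved must have positive measure. -/
def IsWeakGibbs {β : ℝ} (ψ : C(twoSided β, ℝ)) (ν : Measure (twoSided β)) : Prop :=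
  IsInvariantProb ν ∧
    ∀ δ : ℝ, 0 < δ → ∃ N : ℕ, ∀ m : ℕ, N ≤ m → ∀ x : twoSided β,
      0 < ν.real (cylinder m x) ∧
      |(1 / m : ℝ) * Real.log (ν.real (cylinder m x))
        - (1 / m : ℝ) * ∑ l ∈ Finset.range m, ψ (shift (l : ℤ) x)| ≤ δ

end BetaShift

end

/-! Bounded total oscillations give a summable `o` such that the influence between a block of `N`
sites and its complement is at most `bdry o N = o(N)`. Energies of words can therefore be compared,
cut and pasted with subexponential errors.

An equilibrium measure nearly maximizes the finite-volume free energy: along arbitrarily long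
windows, the mean of any window function `f` is at most the increase of the log-partition function
caused by adding `f`, up to `ε` per site (`IsEquilibrium.frequently_integral_le`). Testing with an
`f` that rewards a word `u` and penalizes a word `v` in consecutive blocks yields ν[u] ≤ e^D ν[v]
whenever `u` may be replaced by `v` in every context, where `D` is the energy difference plus a
boundary term (`IsEquilibrium.measureReal_cylinder_le`).

In the β-shift, a word with nonzero first letter may always be replaced by `0 y 0^q` if `q` exceeds
the zero runs of `c` after prefixes of length at most `|y|` (`patch_insertWord_mem`). Summing the
resulting inequality over the replaced words bounds ν[y] from below; summing it over `y` bounds from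
above the measure of a word starting with a nonzero letter. When z̄(n) = o(n), the cost of the
padding is subexponential. For an arbitrary word one looks back to the last nonzero letter,
separated from it by `i` zeros. The strict inequality φ(0) < p(φ)
(`OscBound.apply_zero_lt_pressure`) gives such a configuration a factor of about e^{-i(p(φ)-φ(0))},
so the sum over `i` converges.

For (2), a prefix of `c` of length `l` forces the `p` zeros which follow it, so the cylinders of
lengths `l` and `l + p` coincide (`cylinder_digitPoint`), while the Birkhoff sum of ψ drops by about
p(p(φ)-φ(0)). If `p` is at least a fixed fraction of `l`, the weak Gibbs estimates at these two
lengths contradict each other. -/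

noncomputable section

namespace BetaShift

/-! ### The expansion of 1 and the lexicographic order. -/

section Digits

variable {β : ℝ} [hβ : Fact (1 < β)]

instance instNeZeroCeil : NeZero ⌈β⌉₊ :=
  ⟨(Nat.ceil_pos.2 (zero_lt_one.trans hβ.out)).ne'⟩

/-- Taking `⌈t⌉ - 1` as digit, rather than the floor, keeps every remainder strictly positive; this
is why the expansion cannot end in zeros only. -/
theorem rem_mem_Ioc (β : ℝ) [hβ : Fact (1 < β)] (i : ℕ) : 0 < rem β i ∧ rem β i ≤ 1 := by
  have h1 := hβ.out
  cases i with
  | zero => simp [rem]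
  | succ i =>
    simp only [rem]
    constructor
    · linarith [Int.ceil_lt_add_one (β * rem β i)]
    · linarith [Int.le_ceil (β * rem β i)]

theorem digit_cast (β : ℝ) [hβ : Fact (1 < β)] (i : ℕ) :
    (digit β i : ℝ) = (⌈β * rem β i⌉ : ℝ) - 1 := by
  have h1 := hβ.out
  have hpos : 0 < β * rem β i := mul_pos (by linarith) (rem_mem_Ioc β i).1
  have h2 : 1 ≤ ⌈β * rem β i⌉₊ := Nat.ceil_pos.2 hpos
  rw [digit, Nat.cast_sub h2, natCast_ceil_eq_intCast_ceil hpos.le]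
  simp

theorem rem_succ (β : ℝ) [hβ : Fact (1 < β)] (i : ℕ) :
    rem β (i + 1) = β * rem β i - digit β i := by
  rw [digit_cast]; rfl

theorem digit_mono_of_rem_le {i j : ℕ} (h : rem β i ≤ rem β j) : digit β i ≤ digit β j := by
  have h1 := hβ.out
  exact Nat.sub_le_sub_right (Nat.ceil_mono (mul_le_mul_of_nonneg_left h (by linarith))) 1

theorem digit_lt_ceil (β : ℝ) [hβ : Fact (1 < β)] (i : ℕ) : digit β i < ⌈β⌉₊ := by
  have h1 := hβ.out
  have h2 : ⌈β * rem β i⌉₊ ≤ ⌈β⌉₊ := by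
    apply Nat.ceil_mono
    nlinarith [(rem_mem_Ioc β i).2]
  have h3 : 0 < ⌈β⌉₊ := Nat.ceil_pos.2 (by linarith)
  have h4 : digit β i = ⌈β * rem β i⌉₊ - 1 := rfl
  omega

theorem digit_zero_pos (β : ℝ) [hβ : Fact (1 < β)] : 0 < digit β 0 := by
  have h1 := hβ.out
  have : 1 < ⌈β * rem β 0⌉₊ := by
    rw [Nat.lt_ceil]; simpa [rem] using h1
  have h4 : digit β 0 = ⌈β * rem β 0⌉₊ - 1 := rfl
  omega

/-- If all digits vanished from `l` on, the remainders would grow like `β ^ p`, although they are at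
most 1. Hence the infimum in `zeroRun` is attained. -/
theorem exists_digit_pos (β : ℝ) [hβ : Fact (1 < β)] (l : ℕ) : ∃ p, 0 < digit β (l + p) := by
  have h1 := hβ.out
  by_contra! h
  have key : ∀ p, rem β (l + p) = β ^ p * rem β l := by
    intro p
    induction p with
    | zero => simp
    | succ p ih =>
      have h0 : digit β (l + p) = 0 := Nat.le_zero.1 (h p)
      rw [← add_assoc, rem_succ, ih, h0]; push_cast; ring
  have ht := tendsto_pow_atTop_atTop_of_one_lt h1
  obtain ⟨p, hp⟩ := (ht.eventually_gt_atTop (1 / rem β l)).exists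
  have := (rem_mem_Ioc β (l + p)).2
  rw [key, ← le_div_iff₀ (rem_mem_Ioc β l).1] at this
  linarith

theorem LexLE.trans_strict {a b c : ℕ → ℕ} {i : ℕ} (h1 : ∀ j < i, a j = b j) (h2 : a i < b i)
    (hbc : LexLE b c) : LexLE a c := by
  rcases hbc with rfl | ⟨k, hk1, hk2⟩
  · exact Or.inr ⟨i, h1, h2⟩
  · right
    rcases lt_trichotomy i k with h | h | h
    · exact ⟨i, fun j hj => (h1 j hj).trans (hk1 j (hj.trans h)), by rw [← hk1 i h]; exact h2⟩
    · subst h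
      exact ⟨i, fun j hj => (h1 j hj).trans (hk1 j hj), h2.trans hk2⟩
    · exact ⟨k, fun j hj => (h1 j (hj.trans h)).trans (hk1 j hj), by rw [h1 k h]; exact hk2⟩

theorem LexLE.of_le {a b c : ℕ → ℕ} (h : ∀ i, a i ≤ b i) (hbc : LexLE b c) : LexLE a c := by
  by_cases hab : a = b
  · rwa [hab]
  · have hex : ∃ i, a i ≠ b i := by
      by_contra! h'
      exact hab (funext h')
    classical
    refine LexLE.trans_strict (i := Nat.find hex) (fun j hj => not_not.1 (Nat.find_min hex hj)) ?_ hbc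
    exact lt_of_le_of_ne (h _) (Nat.find_spec hex)

/-- A sequence that starts with a prefix of `c` of length at most `l` (or falls below `c` before
`l`) and continues with a run of zeros longer than that of `c` is below `c`. -/
theorem LexLE.of_zero_run {a b c : ℕ → ℕ} {l q : ℕ} (hbc : LexLE b c) (hab : ∀ i < l, a i = b i)
    (h0 : ∀ i < q, a (l + i) = 0) (hpos : ∃ i < q, 0 < c (l + i)) : LexLE a c := by
  classical
  -- If `a` still agrees with `c` after `l` letters, the first positive digit of `c` beyond `l`
  -- decides. Otherwise the comparison is settled before `l`, where `a` coincides with `b`.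
  by_cases hac : ∀ i < l, a i = c i
  · obtain ⟨i, hi, hci⟩ := hpos
    have hex : ∃ i, 0 < c (l + i) := ⟨i, hci⟩
    have hle : Nat.find hex ≤ i := Nat.find_min' hex hci
    refine Or.inr ⟨l + Nat.find hex, fun j hj => ?_, ?_⟩
    · rcases lt_or_ge j l with hjl | hjl
      · exact hac j hjl
      · obtain ⟨k, rfl⟩ := Nat.exists_eq_add_of_le hjl
        have hk : k < Nat.find hex := by omega
        rw [h0 k (by omega)]
        exact (Nat.le_zero.1 (not_lt.1 (Nat.find_min hex hk))).symm
    · rw [h0 _ (by omega)]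
      exact Nat.find_spec hex
  · push Not at hac
    obtain ⟨i, hi, hne⟩ := hac
    rcases hbc with rfl | ⟨k, hk1, hk2⟩
    · exact absurd (hab i hi) hne
    · have hkl : k < l := by
        by_contra hk
        exact hne ((hab i hi).trans (hk1 i (by omega)))
      exact Or.inr ⟨k, fun j hj => (hab j (hj.trans hkl)).trans (hk1 j hj), by rw [hab k hkl]; exact hk2⟩

theorem LexLE.of_head_lt {a c : ℕ → ℕ} (h : a 0 < c 0) : LexLE a c :=
  Or.inr ⟨0, fun _ hj => absurd hj (Nat.not_lt_zero _), h⟩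

/-- The remainder at `k` is at most 1, the remainder at 0. This order persists as long as the digits
agree, and it then orders the first pair of digits that differ. -/
theorem digit_shift_lexLE (β : ℝ) [hβ : Fact (1 < β)] (k : ℕ) :
    LexLE (fun i => digit β (k + i)) (digit β) := by
  classical
  have h1 := hβ.out
  by_cases h : (fun i => digit β (k + i)) = digit β
  · exact Or.inl h
  · have hex : ∃ i, digit β (k + i) ≠ digit β i := by
      by_contra! h'
      exact h (funext h')
    have hmin : ∀ j < Nat.find hex, digit β (k + j) = digit β j :=
      fun j hj => not_not.1 (Nat.find_min hex hj)
    have hrem : ∀ j ≤ Nat.find hex, rem β (k + j) ≤ rem β j := by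
      intro j
      induction j with
      | zero => intro _; simpa [rem] using (rem_mem_Ioc β k).2
      | succ j ih =>
        intro hj
        rw [← add_assoc, rem_succ, rem_succ, hmin j (by omega)]
        have := mul_le_mul_of_nonneg_left (ih (by omega)) (by linarith : (0 : ℝ) ≤ β)
        linarith
    exact Or.inr ⟨Nat.find hex, hmin,
      lt_of_le_of_ne (digit_mono_of_rem_le (hrem _ le_rfl)) (Nat.find_spec hex)⟩

end Digits

/-! ### Points of the two-sided shift: truncation, insertion of words, forced zeros. -/

section Points

variable {β : ℝ} [hβ : Fact (1 < β)]

theorem mem_twoSided_iff {β : ℝ} {x : ℤ → Alphabet β} :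
    x ∈ twoSided β ↔ ∀ k : ℤ, LexLE (fun i : ℕ => (x (k + i) : ℕ)) (digit β) := by
  constructor
  · intro h k
    simpa using h k 0
  · intro h k l
    have := h (k + l)
    simpa [add_assoc] using this

theorem lexLE_of_mem {β : ℝ} (x : twoSided β) (k : ℤ) :
    LexLE (fun i : ℕ => (x.1 (k + i) : ℕ)) (digit β) :=
  mem_twoSided_iff.1 x.2 k

/-- This heredity is what allows letters to be erased, as in `trunc`. -/
theorem mem_twoSided_of_le {β : ℝ} {x y : ℤ → Alphabet β} (hy : y ∈ twoSided β) (h : ∀ i, x i ≤ y i) :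
    x ∈ twoSided β :=
  mem_twoSided_iff.2 fun k => LexLE.of_le (fun _ => Fin.le_def.1 (h _)) (mem_twoSided_iff.1 hy k)

instance instZeroTwoSided : Zero (twoSided β) :=
  ⟨⟨fun _ => 0, mem_twoSided_iff.2 fun _ => LexLE.of_head_lt (by
    simpa using digit_zero_pos β)⟩⟩

@[simp] theorem zero_apply (i : ℤ) : (0 : twoSided β).1 i = 0 := rfl

@[simp] theorem shift_apply {β : ℝ} (j : ℤ) (x : twoSided β) (i : ℤ) :
    (shift j x).1 i = x.1 (i + j) := rfl

theorem ext_coord {β : ℝ} {x y : twoSided β} (h : ∀ i, x.1 i = y.1 i) : x = y :=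
  Subtype.ext (funext h)

@[simp] theorem shift_zero_point (j : ℤ) : shift j (0 : twoSided β) = 0 := rfl

theorem shift_shift {β : ℝ} (i j : ℤ) (x : twoSided β) : shift i (shift j x) = shift (i + j) x :=
  ext_coord fun k => by simp [add_assoc]

@[simp] theorem shift_zero {β : ℝ} (x : twoSided β) : shift 0 x = x :=
  ext_coord fun _ => by simp

theorem shift_iterate {β : ℝ} (i : ℕ) (x : twoSided β) : (shift 1)^[i] x = shift (i : ℤ) x := by
  induction i with
  | zero => simp
  | succ i ih => rw [Function.iterate_succ_apply', ih, shift_shift]; push_cast; rw [add_comm]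

/-- The point which agrees with `x` on `I` and vanishes outside `I`. -/
def trunc (I : Finset ℤ) (x : twoSided β) : twoSided β :=
  ⟨fun i => if i ∈ I then x.1 i else 0, mem_twoSided_of_le x.2 fun _ => by
    split_ifs
    · exact le_rfl
    · exact Fin.zero_le _⟩

theorem trunc_apply (I : Finset ℤ) (x : twoSided β) (i : ℤ) :
    (trunc I x).1 i = if i ∈ I then x.1 i else 0 := rfl

theorem trunc_apply_of_mem {I : Finset ℤ} (x : twoSided β) {i : ℤ} (h : i ∈ I) :
    (trunc I x).1 i = x.1 i := if_pos h

theorem trunc_apply_of_notMem {I : Finset ℤ} (x : twoSided β) {i : ℤ} (h : i ∉ I) :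
    (trunc I x).1 i = 0 := if_neg h

/-- The sequence which agrees with `v` on `[a, a + m)` and with `x` elsewhere. -/
def patch (a : ℤ) (m : ℕ) (v x : ℤ → Alphabet β) : ℤ → Alphabet β :=
  fun i => if i ∈ Finset.Ico a (a + m) then v i else x i

/-- The point with `x_0 ⋯ x_{n-1}` at the sites `1, …, n` and zeros elsewhere. -/
def insertWord (n : ℕ) (x : twoSided β) : twoSided β :=
  trunc (Finset.Ico 1 (n + 1)) (shift (-1) x)

theorem insertWord_apply (n : ℕ) (x : twoSided β) (i : ℤ) :
    (insertWord n x).1 i = if 1 ≤ i ∧ i < n + 1 then x.1 (i - 1) else 0 := by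
  simp [insertWord, trunc_apply, Finset.mem_Ico, sub_eq_add_neg]

/-- The inserted word is `0 y_0 ⋯ y_{n-1} 0^q`. A sequence read from a site at or left of 0
decreases strictly at 0, where a zero replaces `x_0 ≠ 0`. One read from inside the copy of `y` shows
at most `n` letters of an admissible sequence and then `q` zeros, more than `c` has after such a
prefix. One read from the padding starts with a zero, and further right nothing has changed. -/
theorem patch_insertWord_mem {n q : ℕ} (hq : ∀ l ≤ n, ∃ i < q, 0 < digit β (l + i))
    (y x : twoSided β) (hx : x.1 0 ≠ 0) :
    patch 0 (n + q + 1) (insertWord n y).1 x.1 ∈ twoSided β := by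
  have hval : ∀ i, patch 0 (n + q + 1) (insertWord n y).1 x.1 i =
      if i < 0 then x.1 i else if i = 0 then 0 else if i < n + 1 then y.1 (i - 1) else
        if i < n + q + 1 then 0 else x.1 i := by
    intro i
    simp only [patch, Finset.mem_Ico, insertWord_apply]
    push_cast
    split_ifs <;> first | rfl | omega
  have hx0 : 0 < (x.1 0 : ℕ) := Nat.pos_of_ne_zero fun h => hx (Fin.ext (by simpa using h))
  refine mem_twoSided_iff.2 fun k => ?_
  simp only [hval]
  rcases le_or_gt k 0 with hk | hk
  · obtain ⟨i, rfl⟩ : ∃ i : ℕ, k = -i := ⟨k.natAbs, by omega⟩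
    refine LexLE.trans_strict (i := i) (fun j hj => ?_) ?_ (lexLE_of_mem x (-i))
    · rw [if_pos (by omega)]
    · simpa using hx0
  rcases lt_or_ge k (n + 1) with hkn | hkn
  · obtain ⟨l, hl⟩ : ∃ l : ℕ, k + l = n + 1 := ⟨(n + 1 - k).natAbs, by omega⟩
    refine LexLE.of_zero_run (l := l) (q := q) (lexLE_of_mem y (k - 1)) (fun i hi => ?_)
      (fun i hi => ?_) (hq l (by omega))
    · rw [if_neg (by omega), if_neg (by omega), if_pos (by omega)]
      congr 2; ring_nf
    · push_cast
      rw [if_neg (by omega), if_neg (by omega), if_neg (by omega), if_pos (by omega)]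
      simp
  rcases lt_or_ge k (n + q + 1) with hkq | hkq
  · apply LexLE.of_head_lt
    rw [if_neg (by omega), if_neg (by omega), if_neg (by omega), if_pos (by omega)]
    simpa using digit_zero_pos β
  · convert lexLE_of_mem x k using 3 with i
    rw [if_neg (by omega), if_neg (by omega), if_neg (by omega), if_neg (by omega)]

theorem exists_digit_pos_of_maxZeroRun (β : ℝ) [hβ : Fact (1 < β)] {n l : ℕ} (hl : l ≤ n) :
    ∃ i < maxZeroRun β n + 1, 0 < digit β (l + i) := by
  rcases Nat.eq_zero_or_pos l with rfl | hl0
  · exact ⟨0, by omega, by simpa using digit_zero_pos β⟩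
  · refine ⟨zeroRun β l, Nat.lt_succ_of_le (Finset.le_sup (f := zeroRun β) (by simp; omega)), ?_⟩
    rw [zeroRun, if_neg hl0.ne']
    exact Nat.sInf_mem (s := {p : ℕ | 0 < digit β (l + p)}) (exists_digit_pos β l)

theorem digit_eq_zero_of_lt_zeroRun {β : ℝ} {l i : ℕ} (hi : i < zeroRun β l) : digit β (l + i) = 0 := by
  by_cases hl : l = 0
  · simp [zeroRun, hl] at hi
  · rw [zeroRun, if_neg hl] at hi
    by_contra h
    exact Nat.notMem_of_lt_sInf hi (Nat.pos_of_ne_zero h)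

/-- The point `⋯ 0 0 c_1 c_2 ⋯`. -/
def digitPoint (β : ℝ) [hβ : Fact (1 < β)] : twoSided β :=
  ⟨fun i => if 0 ≤ i then ⟨digit β i.toNat, digit_lt_ceil β _⟩ else 0,
    mem_twoSided_iff.2 fun k => by
      rcases le_or_gt 0 k with hk | hk
      · obtain ⟨k, rfl⟩ := Int.eq_ofNat_of_zero_le hk
        convert digit_shift_lexLE β k using 2 with i
        rw [if_pos (by omega)]
        rfl
      · apply LexLE.of_head_lt
        rw [if_neg (by omega)]
        simpa using digit_zero_pos β⟩

theorem digitPoint_apply (i : ℕ) : ((digitPoint β).1 i : ℕ) = digit β i := by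
  simp [digitPoint]

theorem apply_le_digit_of_prefix {β : ℝ} (y : twoSided β) {l : ℕ}
    (h : ∀ i < l, (y.1 i : ℕ) = digit β i) : (y.1 l : ℕ) ≤ digit β l := by
  rcases lexLE_of_mem y 0 with h' | ⟨k, hk1, hk2⟩
  · simpa using (congrFun h' l).le
  · simp only [zero_add] at hk1 hk2
    rcases lt_trichotomy k l with hkl | hkl | hkl
    · exact absurd (h k hkl) hk2.ne
    · exact hkl ▸ hk2.le
    · exact (hk1 l hkl).le

/-- After a prefix of `c` the next letter is at most the next digit; where that digit is 0, the
letter is forced. Lengthening the cylinder over a zero run therefore imposes no new condition. -/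
theorem cylinder_digitPoint (l : ℕ) :
    cylinder (l + zeroRun β l) (digitPoint β) = cylinder l (digitPoint β) := by
  refine Set.Subset.antisymm (fun y hy i hi => hy i (by omega)) fun y hy => ?_
  have key : ∀ p ≤ zeroRun β l, ∀ i < l + p, (y.1 i : ℕ) = digit β i := by
    intro p
    induction p with
    | zero =>
      intro _ i hi
      rw [hy i hi, digitPoint_apply]
    | succ p ih =>
      intro hp i hi
      rcases Nat.lt_succ_iff_lt_or_eq.1 hi with hi | rfl
      · exact ih (by omega) i hi
      · have h1 := apply_le_digit_of_prefix y (ih (by omega))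
        have h2 := digit_eq_zero_of_lt_zeroRun (β := β) (l := l) (i := p) (by omega)
        show ((y.1 ((l + p : ℕ) : ℤ) : Fin _) : ℕ) = digit β (l + p)
        omega
  exact fun i hi => Fin.ext ((key _ le_rfl i hi).trans (digitPoint_apply i).symm)

end Points

/-! ### Oscillation bounds for Birkhoff sums over blocks. -/

section Oscillation

variable {β : ℝ}

/-- The summable sequence `o` controls the oscillations of `φ`: changing the coordinates in a set
`U` changes `φ` by at most `∑_{k ∈ U} o k`. -/
structure OscBound (φ : C(twoSided β, ℝ)) (o : ℤ → ℝ) : Prop where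
  nonneg : ∀ k, 0 ≤ o k
  summable : Summable o
  abs_sub_le : ∀ x y, |φ x - φ y| ≤ ∑' k, if x.1 k = y.1 k then 0 else o k

theorem summable_ite_of_nonneg {ι : Type*} {o : ι → ℝ} (h0 : ∀ k, 0 ≤ o k) (h : Summable o)
    (p : ι → Prop) [DecidablePred p] : Summable fun k => if p k then 0 else o k :=
  h.of_nonneg_of_le (fun k => by split_ifs <;> simp [h0]) fun k => by split_ifs <;> simp [h0]

theorem abs_sub_le_osc {g : C(ℤ → Alphabet β, ℝ)} {i : ℤ} (hi : osc g i ≠ ∞)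
    {x y : ℤ → Alphabet β} (h : ∀ k, k ≠ i → x k = y k) : |g x - g y| ≤ (osc g i).toReal := by
  have h1 : ENNReal.ofReal |g x - g y| ≤ osc g i :=
    le_iSup_of_le x (le_iSup_of_le y (le_iSup_of_le h le_rfl))
  exact (ENNReal.ofReal_le_iff_le_toReal hi).1 h1

/-- Turn `x` into `y` one coordinate at a time over a finite set `S`, then let `S` exhaust ℤ by
continuity. The intermediate points may leave the β-shift, so the estimate is made for an extension
to the full shift. -/
theorem BoundedTotalOsc.exists_oscBound {φ : C(twoSided β, ℝ)} (h : BoundedTotalOsc φ) :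
    ∃ o, OscBound φ o := by
  classical
  unfold BoundedTotalOsc oscNorm at h
  simp only [iInf_lt_iff] at h
  obtain ⟨g, hg, hosc⟩ := h
  have hne : ∀ i, osc g i ≠ ∞ := fun i => ENNReal.ne_top_of_tsum_ne_top hosc.ne i
  have hs : Summable fun i => (osc g i).toReal := ENNReal.summable_toReal hosc.ne
  refine ⟨fun i => (osc g i).toReal, fun _ => ENNReal.toReal_nonneg, hs, fun x y => ?_⟩
  let z : Finset ℤ → ℤ → Alphabet β := fun S i => if i ∈ S then y.1 i else x.1 i
  have hz : ∀ S : Finset ℤ, |g x.1 - g (z S)| ≤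
      ∑ k ∈ S, if x.1 k = y.1 k then 0 else (osc g k).toReal := by
    intro S
    induction S using Finset.induction_on with
    | empty => simp [z]
    | insert a S ha ih =>
      rw [Finset.sum_insert ha, add_comm]
      refine (abs_sub_le _ (g (z S)) _).trans (add_le_add ih ?_)
      split_ifs with hxy
      · have : z S = z (insert a S) := by
          funext i
          by_cases hi : i = a
          · subst hi; simp [z, ha, hxy]
          · simp [z, hi]
        simp [this]
      · exact abs_sub_le_osc (hne a) fun k hk => by simp [z, hk]
  have htend : Tendsto (fun S => |g x.1 - g (z S)|) atTop (𝓝 |g x.1 - g y.1|) := by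
    have : Tendsto z atTop (𝓝 y.1) := by
      rw [tendsto_pi_nhds]
      intro i
      refine tendsto_const_nhds.congr' ?_
      filter_upwards [eventually_ge_atTop {i}] with S hS
      simp [z, Finset.singleton_subset_iff.1 hS]
    exact ((tendsto_const_nhds.sub ((g.continuous.tendsto _).comp this))).abs
  rw [← hg, ← hg]
  refine le_of_tendsto htend (Eventually.of_forall fun S => (hz S).trans ?_)
  refine (summable_ite_of_nonneg (fun _ => ENNReal.toReal_nonneg) hs _).sum_le_tsum S fun k _ => ?_
  split_ifs <;> simp

/-- The Birkhoff sum over a finite set of sites. -/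
def bsum (φ : C(twoSided β, ℝ)) (J : Finset ℤ) (x : twoSided β) : ℝ := ∑ j ∈ J, φ (shift j x)

/-- A bound for the influence of a block of length `N` on its complement. -/
def bdry (o : ℤ → ℝ) (N : ℕ) : ℝ := ∑' k : ℤ, o k * (min k.natAbs N : ℕ)

theorem summable_mul_card {ι : Type*} {o : ι → ℝ} (h0 : ∀ k, 0 ≤ o k) (h : Summable o)
    {c : ι → ℕ} {C : ℕ} (hc : ∀ k, c k ≤ C) : Summable fun k => o k * c k :=
  (h.mul_right (C : ℝ)).of_nonneg_of_le (fun k => mul_nonneg (h0 k) (Nat.cast_nonneg _))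
    fun k => mul_le_mul_of_nonneg_left (Nat.cast_le.2 (hc k)) (h0 k)

theorem bdry_nonneg {o : ℤ → ℝ} (h0 : ∀ k, 0 ≤ o k) (N : ℕ) : 0 ≤ bdry o N :=
  tsum_nonneg fun k => mul_nonneg (h0 k) (Nat.cast_nonneg _)

theorem bdry_mono {o : ℤ → ℝ} (h0 : ∀ k, 0 ≤ o k) (hs : Summable o) : Monotone (bdry o) := by
  intro M N h
  refine (summable_mul_card h0 hs fun k => min_le_right _ M).tsum_le_tsum (fun k => ?_)
    (summable_mul_card h0 hs fun k => min_le_right _ N)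
  exact mul_le_mul_of_nonneg_left (Nat.cast_le.2 (min_le_min_left _ h)) (h0 k)

/-- Dominated convergence: each term `o k * min |k| N / N` tends to 0 and is at most `o k`. Boundary
terms are thus invisible on the exponential scale. -/
theorem tendsto_bdry_div {o : ℤ → ℝ} (h0 : ∀ k, 0 ≤ o k) (hs : Summable o) :
    Tendsto (fun N : ℕ => bdry o N / N) atTop (𝓝 0) := by
  have key : Tendsto (fun N : ℕ => ∑' k : ℤ, o k * (min k.natAbs N : ℕ) / N) atTop
      (𝓝 (∑' _ : ℤ, (0 : ℝ))) := by
    refine tendsto_tsum_of_dominated_convergence hs (fun k => ?_) ?_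
    · refine squeeze_zero (fun N => div_nonneg (mul_nonneg (h0 k) (Nat.cast_nonneg _))
        (Nat.cast_nonneg _)) (fun N => ?_) (tendsto_const_div_atTop_nhds_zero_nat (o k * k.natAbs))
      gcongr
      · exact h0 k
      · exact min_le_left _ _
    · refine Eventually.of_forall fun N k => ?_
      rw [Real.norm_of_nonneg (div_nonneg (mul_nonneg (h0 k) (Nat.cast_nonneg _))
        (Nat.cast_nonneg _))]
      refine div_le_of_le_mul₀ (Nat.cast_nonneg _) (h0 k) ?_
      exact mul_le_mul_of_nonneg_left (Nat.cast_le.2 (min_le_right _ _)) (h0 k)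
  simpa only [tsum_zero, tsum_div_const, bdry] using key

theorem bdry_le_eventually {o : ℤ → ℝ} (h0 : ∀ k, 0 ≤ o k) (hs : Summable o) {ε : ℝ}
    (hε : 0 < ε) : ∀ᶠ N : ℕ in atTop, bdry o N ≤ ε * N := by
  filter_upwards [(tendsto_bdry_div h0 hs).eventually_lt_const hε, eventually_gt_atTop 0]
    with N hN hN0
  rw [div_lt_iff₀ (by exact_mod_cast hN0)] at hN
  exact hN.le

variable {φ : C(twoSided β, ℝ)} {o : ℤ → ℝ}

/-- Coordinate `k` of `shift j x` is the site `k + j`. After exchanging sums, the weight of `o k` is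
the number of `j ∈ J` for which `x` and `y` differ at `k + j`. -/
theorem OscBound.abs_bsum_sub_le (ho : OscBound φ o) (J : Finset ℤ) (x y : twoSided β) {c : ℤ → ℕ}
    {C : ℕ} (hc : ∀ k, (J.filter fun j => x.1 (k + j) ≠ y.1 (k + j)).card ≤ c k)
    (hC : ∀ k, c k ≤ C) : |bsum φ J x - bsum φ J y| ≤ ∑' k, o k * c k := by
  have hsum : ∀ j, Summable fun k : ℤ => if x.1 (k + j) = y.1 (k + j) then 0 else o k :=
    fun j => summable_ite_of_nonneg ho.nonneg ho.summable _
  calc |bsum φ J x - bsum φ J y| ≤ ∑ j ∈ J, |φ (shift j x) - φ (shift j y)| := by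
        rw [bsum, bsum, ← Finset.sum_sub_distrib]
        exact Finset.abs_sum_le_sum_abs _ _
    _ ≤ ∑ j ∈ J, ∑' k, if x.1 (k + j) = y.1 (k + j) then 0 else o k :=
        Finset.sum_le_sum fun j _ => ho.abs_sub_le _ _
    _ = ∑' k, ∑ j ∈ J, if x.1 (k + j) = y.1 (k + j) then 0 else o k :=
        (Summable.tsum_finsetSum fun j _ => hsum j).symm
    _ ≤ ∑' k, o k * c k := by
        refine (summable_sum fun j _ => hsum j).tsum_le_tsum (fun k => ?_)
          (summable_mul_card ho.nonneg ho.summable hC)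
        rw [Finset.sum_ite, Finset.sum_const_zero, zero_add, Finset.sum_const, nsmul_eq_mul,
          mul_comm]
        exact mul_le_mul_of_nonneg_left (Nat.cast_le.2 (hc k)) (ho.nonneg k)

theorem card_exit_le (a k : ℤ) (N : ℕ) :
    ((Finset.Ico a (a + N)).filter fun j => k + j ∉ Finset.Ico a (a + N)).card
      ≤ min k.natAbs N := by
  refine le_min ?_ ((Finset.card_filter_le _ _).trans (by simp))
  rcases le_total 0 k with hk | hk
  · calc _ ≤ (Finset.Ico (a + N - k) (a + N)).card := Finset.card_le_card fun j hj => by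
          simp only [Finset.mem_filter, Finset.mem_Ico] at hj ⊢; omega
      _ = _ := by rw [Int.card_Ico]; omega
  · calc _ ≤ (Finset.Ico a (a - k)).card := Finset.card_le_card fun j hj => by
          simp only [Finset.mem_filter, Finset.mem_Ico] at hj ⊢; omega
      _ = _ := by rw [Int.card_Ico]; omega

theorem OscBound.abs_bsum_sub_le_of_eq_on (ho : OscBound φ o) {a : ℤ} {N : ℕ} {J : Finset ℤ}
    (hJ : J ⊆ Finset.Ico a (a + N)) {x y : twoSided β}
    (h : ∀ i ∈ Finset.Ico a (a + N), x.1 i = y.1 i) :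
    |bsum φ J x - bsum φ J y| ≤ bdry o N := by
  refine ho.abs_bsum_sub_le J x y (fun k => (Finset.card_le_card fun j hj => ?_).trans
    (card_exit_le a k N)) fun k => min_le_right _ N
  simp only [Finset.mem_filter] at hj ⊢
  exact ⟨hJ hj.1, fun hm => hj.2 (h _ hm)⟩

/-- The relevant `j` lie outside the block with `k + j` inside it; through `j ↦ k + j` they become
the sites that leave the block under translation by `-k`. -/
theorem OscBound.abs_bsum_sub_le_of_eq_off (ho : OscBound φ o) {a : ℤ} {N : ℕ} {J : Finset ℤ}
    (hJ : ∀ j ∈ J, j ∉ Finset.Ico a (a + N)) {x y : twoSided β}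
    (h : ∀ i ∉ Finset.Ico a (a + N), x.1 i = y.1 i) :
    |bsum φ J x - bsum φ J y| ≤ bdry o N := by
  refine ho.abs_bsum_sub_le J x y (fun k => ?_) fun k => min_le_right _ N
  have h1 := card_exit_le a (-k) N
  rw [Int.natAbs_neg] at h1
  refine (Finset.card_le_card_of_injOn (fun j => k + j) (fun j hj => ?_)
    (fun i _ j _ hij => add_left_cancel hij)).trans h1
  simp only [Finset.coe_filter, Set.mem_ofPred_eq] at hj ⊢
  refine ⟨?_, by simpa using hJ j hj.1⟩
  by_contra hm
  exact hj.2 (h _ hm)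

theorem OscBound.abs_bsum_sub_le_card (ho : OscBound φ o) (J U : Finset ℤ) {x y : twoSided β}
    (h : ∀ i ∉ U, x.1 i = y.1 i) : |bsum φ J x - bsum φ J y| ≤ (∑' k, o k) * U.card := by
  rw [← tsum_mul_right]
  refine ho.abs_bsum_sub_le J x y (fun k => ?_) fun _ => le_rfl
  refine Finset.card_le_card_of_injOn (fun j => k + j) (fun j hj => ?_)
    (fun i _ j _ hij => add_left_cancel hij)
  simp only [Finset.coe_filter, Set.mem_ofPred_eq] at hj
  by_contra hm
  exact hj.2 (h _ hm)

theorem OscBound.abs_apply_le [Fact (1 < β)] (ho : OscBound φ o) (x : twoSided β) :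
    |φ x| ≤ |φ 0| + ∑' k, o k := by
  have h1 := (ho.abs_sub_le x 0).trans ((summable_ite_of_nonneg ho.nonneg ho.summable _).tsum_le_tsum
    (fun k => by split_ifs <;> simp [ho.nonneg]) ho.summable)
  have h2 := abs_add_le (φ x - φ 0) (φ 0)
  rw [sub_add_cancel] at h2
  linarith

theorem abs_bsum_le {C : ℝ} (hC : ∀ x, |φ x| ≤ C) (J : Finset ℤ) (x : twoSided β) :
    |bsum φ J x| ≤ J.card * C := by
  refine (Finset.abs_sum_le_sum_abs _ _).trans ((Finset.sum_le_sum fun j _ => hC _).trans ?_)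
  simp

theorem bsum_shift (φ : C(twoSided β, ℝ)) (a b c : ℤ) (x : twoSided β) :
    bsum φ (Finset.Ico a b) (shift c x) = bsum φ (Finset.Ico (a + c) (b + c)) x := by
  rw [bsum, bsum, ← Finset.map_add_right_Ico, Finset.sum_map]
  simp [shift_shift]

theorem bsum_Ico_add (φ : C(twoSided β, ℝ)) {a b c : ℤ} (hab : a ≤ b) (hbc : b ≤ c)
    (x : twoSided β) :
    bsum φ (Finset.Ico a c) x = bsum φ (Finset.Ico a b) x + bsum φ (Finset.Ico b c) x := by
  rw [bsum, ← Finset.Ico_union_Ico_eq_Ico hab hbc, Finset.sum_union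
    (Finset.Ico_disjoint_Ico_consecutive a b c)]
  rfl

theorem bsum_range (φ : C(twoSided β, ℝ)) (n : ℕ) (x : twoSided β) :
    ∑ l ∈ Finset.range n, φ (shift (l : ℤ) x) = bsum φ (Finset.Ico 0 (n : ℤ)) x := by
  rw [bsum]
  refine Finset.sum_bij (fun (l : ℕ) _ => (l : ℤ)) (fun l hl => ?_) (fun a _ b _ h => by simpa using h)
    (fun b hb => ?_) fun l _ => rfl
  · simp at hl ⊢; exact hl
  · simp only [Finset.mem_Ico] at hb
    exact ⟨b.toNat, by simp; omega, by omega⟩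

@[simp] theorem bsum_zero_point [Fact (1 < β)] (φ : C(twoSided β, ℝ)) (J : Finset ℤ) :
    bsum φ J 0 = J.card * φ 0 := by
  simp [bsum]

end Oscillation

/-! ### Window partition functions and the pressure. -/

section Partition

variable {β : ℝ} [hβ : Fact (1 < β)]

theorem supported_finite (β : ℝ) [Fact (1 < β)] (m : ℕ) :
    {x : twoSided β | ∀ i ∉ Finset.Ico (0 : ℤ) m, x.1 i = 0}.Finite := by
  refine Set.Finite.of_finite_image
    (f := fun (x : twoSided β) (j : Finset.Ico (0 : ℤ) m) => x.1 j.1) (Set.toFinite _) ?_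
  intro x hx y hy hxy
  refine ext_coord fun j => ?_
  by_cases hj : j ∈ Finset.Ico (0 : ℤ) m
  · exact congrFun hxy ⟨j, hj⟩
  · rw [hx j hj, hy j hj]

/-- The points which vanish outside `[0, m)`; they represent the words of length `m`. -/
def words (β : ℝ) [Fact (1 < β)] (m : ℕ) : Finset (twoSided β) := (supported_finite β m).toFinset

theorem mem_words {m : ℕ} {x : twoSided β} :
    x ∈ words β m ↔ ∀ i ∉ Finset.Ico (0 : ℤ) m, x.1 i = 0 := by
  simp [words]

theorem zero_mem_words (m : ℕ) : (0 : twoSided β) ∈ words β m := mem_words.2 fun _ _ => rfl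

theorem trunc_mem_words (m : ℕ) (x : twoSided β) : trunc (Finset.Ico 0 (m : ℤ)) x ∈ words β m :=
  mem_words.2 fun _ hi => trunc_apply_of_notMem x hi

theorem eq_of_mem_words {m : ℕ} {x y : twoSided β} (hx : x ∈ words β m) (hy : y ∈ words β m)
    (h : ∀ i ∈ Finset.Ico (0 : ℤ) m, x.1 i = y.1 i) : x = y := by
  refine ext_coord fun i => ?_
  by_cases hi : i ∈ Finset.Ico (0 : ℤ) m
  · exact h i hi
  · rw [mem_words.1 hx i hi, mem_words.1 hy i hi]

/-- The partition function of the window `[0, m)`. -/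
def windowZ (φ : C(twoSided β, ℝ)) (m : ℕ) : ℝ :=
  ∑ y ∈ words β m, Real.exp (bsum φ (Finset.Ico 0 (m : ℤ)) y)

theorem windowZ_pos (φ : C(twoSided β, ℝ)) (m : ℕ) : 0 < windowZ φ m :=
  Finset.sum_pos (fun _ _ => Real.exp_pos _) ⟨0, zero_mem_words m⟩

theorem partitionFn_eq_windowZ (φ : C(twoSided β, ℝ)) (n : ℕ) :
    partitionFn φ n = windowZ φ (2 * n + 1) := by
  refine Finset.sum_bij' (fun x _ => shift (-n : ℤ) x) (fun x _ => shift (n : ℤ) x)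
    (fun x hx => ?_) (fun x hx => ?_) (fun x _ => ?_) (fun x _ => ?_) fun x _ => ?_
  · rw [Set.Finite.mem_toFinset] at hx
    refine mem_words.2 fun i hi => Fin.ext ?_
    simp only [Finset.mem_Ico] at hi
    push_cast at hi
    refine hx (i + -n) ?_
    rw [lt_abs]; omega
  · rw [Set.Finite.mem_toFinset]
    intro j hj
    have : (shift (n : ℤ) x).1 j = 0 := by
      rw [shift_apply]
      refine mem_words.1 hx _ ?_
      rw [lt_abs] at hj
      simp only [Finset.mem_Ico]; push_cast; omega
    rw [this]; rfl
  · simp [shift_shift]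
  · simp [shift_shift]
  · rw [bsum_shift]
    congr 1
    refine Finset.sum_congr (Finset.ext fun j => ?_) fun _ _ => rfl
    simp only [Finset.mem_Icc, Finset.mem_Ico]; push_cast; omega

variable {φ : C(twoSided β, ℝ)} {o : ℤ → ℝ}

theorem mul_apply_zero_le_log_windowZ (φ : C(twoSided β, ℝ)) (m : ℕ) :
    m * φ 0 ≤ Real.log (windowZ φ m) := by
  rw [Real.le_log_iff_exp_le (windowZ_pos φ m)]
  have := Finset.single_le_sum (f := fun y => Real.exp (bsum φ (Finset.Ico 0 (m : ℤ)) y))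
    (fun y _ => (Real.exp_pos _).le) (zero_mem_words (β := β) m)
  simpa [windowZ] using this

/-- A word followed by a zero is again a word. This transfers bounds to even lengths, since
`pressure` only involves odd ones. -/
theorem log_windowZ_le_succ {C : ℝ} (hC : ∀ x, |φ x| ≤ C) (m : ℕ) :
    Real.log (windowZ φ m) ≤ Real.log (windowZ φ (m + 1)) + C := by
  rw [← Real.log_exp C, ← Real.log_mul (windowZ_pos φ _).ne' (Real.exp_pos _).ne']
  refine Real.log_le_log (windowZ_pos φ m) ?_
  rw [windowZ, windowZ, Finset.sum_mul]
  have hsub : words β m ⊆ words β (m + 1) := fun x hx => mem_words.2 fun i hi =>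
    mem_words.1 hx i fun h => hi (by simp only [Finset.mem_Ico] at h ⊢; push_cast; omega)
  refine (Finset.sum_le_sum fun x _ => ?_).trans
    (Finset.sum_le_sum_of_subset_of_nonneg hsub fun _ _ _ => by positivity)
  rw [← Real.exp_add, Real.exp_le_exp,
    bsum_Ico_add φ (b := m) (c := (m + 1 : ℕ)) (by omega) (by push_cast; omega)]
  have h1 := abs_bsum_le hC (Finset.Ico (m : ℤ) (m + 1 : ℕ)) x
  rw [Int.card_Ico] at h1
  push_cast at h1
  simp at h1
  have := abs_le.1 h1
  push_cast
  linarith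

/-- Cutting at `M` injects words into pairs of words. One boundary term pays for erasing the second
block, as seen from the first; the other for erasing everything outside the second block. Neither
depends on `M`, so blocks of length `N` can be split off repeatedly. -/
theorem OscBound.windowZ_add_le (ho : OscBound φ o) (M N : ℕ) :
    windowZ φ (M + N) ≤ windowZ φ M * windowZ φ N * Real.exp (2 * bdry o N) := by
  classical
  rw [windowZ, windowZ, windowZ, Finset.sum_mul_sum, ← Finset.sum_product', Finset.sum_mul]
  let F : twoSided β → twoSided β × twoSided β := fun y =>
    (trunc (Finset.Ico 0 (M : ℤ)) y, trunc (Finset.Ico 0 (N : ℤ)) (shift M y))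
  have hinj : Set.InjOn F (words β (M + N)) := by
    intro x hx y hy hxy
    refine eq_of_mem_words hx hy fun i hi => ?_
    simp only [Finset.mem_Ico] at hi
    push_cast at hi
    rcases lt_or_ge i M with h | h
    · have := congrFun (congrArg Subtype.val (congrArg Prod.fst hxy)) i
      simp only [F] at this
      rwa [trunc_apply_of_mem _ (by simp; omega), trunc_apply_of_mem _ (by simp; omega)] at this
    · have := congrFun (congrArg Subtype.val (congrArg Prod.snd hxy)) (i - M)
      simp only [F] at this
      rw [trunc_apply_of_mem _ (by simp; omega), trunc_apply_of_mem _ (by simp; omega)] at this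
      simpa using this
  calc ∑ y ∈ words β (M + N), Real.exp (bsum φ (Finset.Ico 0 ((M + N : ℕ) : ℤ)) y)
      ≤ ∑ y ∈ words β (M + N), Real.exp (bsum φ (Finset.Ico 0 (M : ℤ)) (F y).1) *
          Real.exp (bsum φ (Finset.Ico 0 (N : ℤ)) (F y).2) * Real.exp (2 * bdry o N) := by
        refine Finset.sum_le_sum fun y hy => ?_
        rw [← Real.exp_add, ← Real.exp_add, Real.exp_le_exp,
          bsum_Ico_add φ (b := M) (c := ((M + N : ℕ) : ℤ)) (by omega) (by push_cast; omega)]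
        have h1 : |bsum φ (Finset.Ico 0 (M : ℤ)) y - bsum φ (Finset.Ico 0 (M : ℤ)) (F y).1|
            ≤ bdry o N := by
          refine ho.abs_bsum_sub_le_of_eq_off (a := M) (fun j hj => ?_) fun i hi => ?_
          · simp only [Finset.mem_Ico] at hj ⊢; omega
          · simp only [F, trunc_apply]
            split_ifs with h
            · rfl
            · refine mem_words.1 hy i ?_
              simp only [Finset.mem_Ico] at hi h ⊢
              push_cast; omega
        have h2 : |bsum φ (Finset.Ico 0 (N : ℤ)) (shift M y)
            - bsum φ (Finset.Ico 0 (N : ℤ)) (F y).2| ≤ bdry o N := by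
          refine ho.abs_bsum_sub_le_of_eq_on (a := 0) (by simp) fun i hi => ?_
          rw [zero_add] at hi
          exact (trunc_apply_of_mem _ hi).symm
        rw [bsum_shift] at h2
        have e : Finset.Ico (0 + (M : ℤ)) (N + M) = Finset.Ico (M : ℤ) ((M + N : ℕ) : ℤ) := by
          push_cast; rw [zero_add, add_comm]
        rw [e] at h2
        have := (abs_le.1 h1).2
        have := (abs_le.1 h2).2
        linarith
    _ = ∑ p ∈ (words β (M + N)).image F, Real.exp (bsum φ (Finset.Ico 0 (M : ℤ)) p.1) *
          Real.exp (bsum φ (Finset.Ico 0 (N : ℤ)) p.2) * Real.exp (2 * bdry o N) := by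
        rw [Finset.sum_image hinj]
    _ ≤ _ := by
        refine Finset.sum_le_sum_of_subset_of_nonneg (fun p hp => ?_) fun _ _ _ => by positivity
        obtain ⟨y, -, rfl⟩ := Finset.mem_image.1 hp
        exact Finset.mem_product.2 ⟨trunc_mem_words _ _, trunc_mem_words _ _⟩

theorem OscBound.log_windowZ_add_le (ho : OscBound φ o) (M N : ℕ) :
    Real.log (windowZ φ (M + N)) ≤
      Real.log (windowZ φ M) + (Real.log (windowZ φ N) + 2 * bdry o N) := by
  have h := Real.log_le_log (windowZ_pos φ _) (ho.windowZ_add_le M N)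
  rw [Real.log_mul (mul_pos (windowZ_pos φ _) (windowZ_pos φ _)).ne' (Real.exp_pos _).ne',
    Real.log_mul (windowZ_pos φ _).ne' (windowZ_pos φ _).ne', Real.log_exp] at h
  linarith

theorem OscBound.log_windowZ_add_mul_le (ho : OscBound φ o) (M N q : ℕ) :
    Real.log (windowZ φ (M + q * N)) ≤
      Real.log (windowZ φ M) + q * (Real.log (windowZ φ N) + 2 * bdry o N) := by
  induction q with
  | zero => simp
  | succ q ih =>
    have := ho.log_windowZ_add_le (M + q * N) N
    rw [show M + (q + 1) * N = M + q * N + N by ring]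
    push_cast
    linarith

theorem pressure_eq_limsup (φ : C(twoSided β, ℝ)) :
    pressure φ = limsup (fun n : ℕ => Real.log (windowZ φ (2 * n + 1)) / (2 * n + 1)) atTop := by
  simp only [pressure, partitionFn_eq_windowZ]

theorem OscBound.isBoundedUnder (ho : OscBound φ o) :
    IsBoundedUnder (· ≤ ·) atTop
      (fun n : ℕ => Real.log (windowZ φ (2 * n + 1)) / (2 * n + 1)) := by
  refine isBoundedUnder_of
    ⟨|Real.log (windowZ φ 0)| + |Real.log (windowZ φ 1) + 2 * bdry o 1|, fun n => ?_⟩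
  rw [div_le_iff₀ (by positivity)]
  have h := ho.log_windowZ_add_mul_le 0 1 (2 * n + 1)
  simp only [zero_add, mul_one] at h
  push_cast at h
  have h1 := le_abs_self (Real.log (windowZ φ 0))
  have h2 := le_abs_self (Real.log (windowZ φ 1) + 2 * bdry o 1)
  have h3 := abs_nonneg (Real.log (windowZ φ 0))
  have hn : (0 : ℝ) ≤ n := Nat.cast_nonneg n
  nlinarith [mul_nonneg hn h3, mul_le_mul_of_nonneg_left h2 hn]

theorem isCoboundedUnder_log_windowZ (φ : C(twoSided β, ℝ)) :
    IsCoboundedUnder (· ≤ ·) atTop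
      (fun n : ℕ => Real.log (windowZ φ (2 * n + 1)) / (2 * n + 1)) := by
  refine IsBoundedUnder.isCoboundedUnder_le (isBoundedUnder_of ⟨φ 0, fun n => ?_⟩)
  have h := mul_apply_zero_le_log_windowZ φ (2 * n + 1)
  push_cast at h
  show φ 0 ≤ _
  rw [le_div_iff₀ (by positivity)]
  linarith

theorem OscBound.log_windowZ_le_eventually (ho : OscBound φ o) {ε : ℝ} (hε : 0 < ε) :
    ∀ᶠ m : ℕ in atTop, Real.log (windowZ φ m) ≤ m * (pressure φ + ε) := by
  have h1 : ∀ᶠ n : ℕ in atTop,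
      Real.log (windowZ φ (2 * n + 1)) / (2 * n + 1) < pressure φ + ε / 2 := by
    refine eventually_lt_of_limsup_lt ?_ ho.isBoundedUnder
    rw [← pressure_eq_limsup]; linarith
  have hdiv : Tendsto (fun m : ℕ => m / 2) atTop atTop :=
    Nat.tendsto_div_const_atTop (by norm_num)
  set C := |φ 0| + ∑' k, o k with hCdef
  have hC : ∀ x, |φ x| ≤ C := ho.abs_apply_le
  have hC0 : 0 ≤ C := (abs_nonneg _).trans (hC 0)
  -- The threshold lets `m * ε / 2` absorb the `C + p + ε / 2` lost in passing from an even length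
  -- to the next odd one.
  filter_upwards [hdiv.eventually h1, (tendsto_natCast_atTop_atTop (R := ℝ)).eventually_ge_atTop
    ((C + |pressure φ| + ε / 2) / (ε / 2))] with m hm hlarge
  rw [div_lt_iff₀ (by positivity)] at hm
  rw [div_le_iff₀ (by positivity)] at hlarge
  have hp := le_abs_self (pressure φ)
  have hp0 := abs_nonneg (pressure φ)
  rcases Nat.even_or_odd' m with ⟨k, rfl | rfl⟩
  · have e : 2 * k / 2 = k := by omega
    rw [e] at hm
    have := log_windowZ_le_succ hC (2 * k)
    push_cast at hlarge ⊢
    nlinarith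
  · have e : (2 * k + 1) / 2 = k := by omega
    rw [e] at hm
    push_cast at hlarge ⊢
    nlinarith

/-- Fekete's argument: write an odd length as `r + q * N` with `r < N`, split off the `q` blocks,
and let the length grow. -/
theorem OscBound.mul_pressure_le (ho : OscBound φ o) (N : ℕ) :
    N * pressure φ ≤ Real.log (windowZ φ N) + 2 * bdry o N := by
  rcases Nat.eq_zero_or_pos N with rfl | hN
  · have h1 := bdry_nonneg ho.nonneg 0
    have h2 := mul_apply_zero_le_log_windowZ φ 0
    simp only [Nat.cast_zero, zero_mul] at h2 ⊢
    linarith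
  set a := Real.log (windowZ φ N) + 2 * bdry o N with ha
  have hNR : (0 : ℝ) < N := by exact_mod_cast hN
  by_contra! hlt
  set d := pressure φ - a / N with hd
  have hd0 : 0 < d := by rw [hd, sub_pos, div_lt_iff₀ hNR]; linarith
  obtain ⟨R, hR⟩ : ∃ R, ∀ r ∈ Finset.range N, Real.log (windowZ φ r) ≤ R :=
    ⟨∑ r ∈ Finset.range N, |Real.log (windowZ φ r)|, fun r hr => (le_abs_self _).trans
      (Finset.single_le_sum (f := fun r => |Real.log (windowZ φ r)|) (fun _ _ => abs_nonneg _) hr)⟩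
  have hfreq : ∃ᶠ n : ℕ in atTop,
      pressure φ - d / 2 < Real.log (windowZ φ (2 * n + 1)) / (2 * n + 1) := by
    refine frequently_lt_of_lt_limsup (isCoboundedUnder_log_windowZ φ) ?_
    rw [← pressure_eq_limsup]; linarith
  -- `R` bounds the remainder block and `|a|` the rounding error in `q ≈ (2n+1)/N`; beyond this
  -- threshold both fit into `(2n+1) * d / 2`.
  obtain ⟨n, hn, hlarge⟩ := (hfreq.and_eventually
    ((tendsto_natCast_atTop_atTop (R := ℝ)).eventually_gt_atTop ((R + |a|) / d))).exists
  rw [lt_div_iff₀ (by positivity)] at hn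
  rw [div_lt_iff₀ hd0] at hlarge
  have hq := ho.log_windowZ_add_mul_le ((2 * n + 1) % N) N ((2 * n + 1) / N)
  rw [Nat.mod_add_div' (2 * n + 1) N, ← ha] at hq
  have hr := hR _ (Finset.mem_range.2 (Nat.mod_lt (2 * n + 1) hN))
  have hqa : (((2 * n + 1) / N : ℕ) : ℝ) * a ≤ (2 * n + 1) * (a / N) + |a| := by
    have hmod : (((2 * n + 1) % N : ℕ) : ℝ) + (((2 * n + 1) / N : ℕ) : ℝ) * N = 2 * n + 1 := by
      exact_mod_cast Nat.mod_add_div' (2 * n + 1) N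
    have hmlt : (((2 * n + 1) % N : ℕ) : ℝ) ≤ N := by
      exact_mod_cast (Nat.mod_lt (2 * n + 1) hN).le
    rw [← hmod, add_mul, mul_assoc, mul_div_cancel₀ _ hNR.ne']
    have h1 : -|a| ≤ (((2 * n + 1) % N : ℕ) : ℝ) * (a / N) := by
      rw [← mul_div_assoc, le_div_iff₀ hNR]
      nlinarith [neg_abs_le a, abs_nonneg a, (Nat.cast_nonneg ((2 * n + 1) % N) : (0 : ℝ) ≤ _)]
    linarith
  have e : (2 * n + 1) * (a / N) = (2 * n + 1) * pressure φ - (2 * n + 1) * d := by rw [hd]; ring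
  nlinarith

/-- Let `c_{p+2}` be a positive digit. A letter 1 followed by at least `p + 1` zeros is below `c`,
because `c_1 ≥ 1` and `c` has a positive digit within that stretch. Ones can therefore be placed
freely on the multiples of `p + 2`. -/
theorem exists_sparse_point (β : ℝ) [Fact (1 < β)] : ∃ L : ℕ, 0 < L ∧ ∀ S : Finset ℕ,
    ∃ x : twoSided β, ∀ i, x.1 i ≠ 0 ↔ ∃ s ∈ S, i = L * s := by
  classical
  obtain ⟨p, hp⟩ := exists_digit_pos β 1
  have h0 := digit_zero_pos β
  have h1lt : 1 < ⌈β⌉₊ := lt_of_le_of_lt h0 (digit_lt_ceil β 0)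
  refine ⟨p + 2, by omega, fun S => ?_⟩
  let x : ℤ → Alphabet β := fun i => if ∃ s ∈ S, i = ((p + 2 : ℕ) : ℤ) * s then ⟨1, h1lt⟩ else 0
  have hxle : ∀ i, (x i : ℕ) ≤ 1 := fun i => by simp only [x]; split_ifs <;> simp
  have hx : x ∈ twoSided β := by
    refine mem_twoSided_iff.2 fun k => ?_
    by_cases hk : ∃ s ∈ S, k = ((p + 2 : ℕ) : ℤ) * s
    · obtain ⟨s, -, rfl⟩ := hk
      -- Raising the leading 1 to `c_1` gives a prefix of `c` of length one, to which the zero-run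
      -- criterion applies.
      refine LexLE.of_le
        (b := fun i : ℕ => if i = 0 then digit β 0 else (x (((p + 2 : ℕ) : ℤ) * s + i) : ℕ))
        (fun i => ?_) ?_
      · split_ifs with hi
        · exact (hxle _).trans h0
        · exact le_rfl
      · refine LexLE.of_zero_run (b := digit β) (l := 1) (q := p + 1) (Or.inl rfl)
          (fun i hi => ?_) (fun i hi => ?_) ⟨p, by omega, hp⟩
        · obtain rfl : i = 0 := by omega
          rfl
        · have : x (((p + 2 : ℕ) : ℤ) * s + (1 + i : ℕ)) = 0 := by
            refine if_neg ?_
            rintro ⟨t, -, ht⟩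
            have hd : ((p + 2 : ℕ) : ℤ) ∣ ((1 + i : ℕ) : ℤ) := ⟨t - s, by rw [mul_sub, ← ht]; ring⟩
            have := Nat.le_of_dvd (by omega) (Int.natCast_dvd_natCast.1 hd)
            omega
          rw [if_neg (by omega), this]
          rfl
    · refine LexLE.of_head_lt ?_
      have : x k = 0 := if_neg hk
      simpa [this] using h0
  refine ⟨⟨x, hx⟩, fun i => ?_⟩
  have h1 : (⟨1, h1lt⟩ : Alphabet β) ≠ 0 := fun h => by simpa using congrArg Fin.val h
  by_cases h : ∃ s ∈ S, i = ((p + 2 : ℕ) : ℤ) * s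
  · exact iff_of_true (by simp only [x]; rwa [if_pos h]) h
  · exact iff_of_false (by simp only [x]; rw [if_neg h]; simp) h

/-- Each optional 1 changes the energy by at most `K = ∑ o k`, so the sparse points give `Z_{LB} ≥
e^{LBφ(0)} (1 + e^{-K})^B`: a gain of `κ / L` per site over the zero word alone. -/
theorem OscBound.apply_zero_lt_pressure (ho : OscBound φ o) : φ 0 < pressure φ := by
  classical
  obtain ⟨L, hL, hsp⟩ := exists_sparse_point β
  choose x hx using hsp
  set K := ∑' k, o k with hK
  have hLR : (0 : ℝ) < L := by exact_mod_cast hL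
  have hcount : ∀ B : ℕ, (L * B : ℕ) * φ 0 + B * Real.log (1 + Real.exp (-K)) ≤
      Real.log (windowZ φ (L * B)) := by
    intro B
    rw [Real.le_log_iff_exp_le (windowZ_pos φ _), Real.exp_add, mul_comm (B : ℝ),
      Real.exp_mul (Real.log _), Real.exp_log (by positivity), Real.rpow_natCast]
    have hpow : (1 + Real.exp (-K)) ^ B =
        ∑ S ∈ (Finset.range B).powerset, Real.exp (-K) ^ S.card := by
      have := Finset.sum_pow_mul_eq_add_pow (Real.exp (-K)) 1 (Finset.range B)
      simpa [add_comm] using this.symm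
    have hinj : Set.InjOn x ((Finset.range B).powerset : Set (Finset ℕ)) := by
      intro S _ S' _ h
      ext s
      have h1 := hx S (L * s)
      have h2 := hx S' (L * s)
      rw [h] at h1
      have h3 := h1.symm.trans h2
      have hL' : L ≠ 0 := by omega
      simpa [hL'] using h3
    rw [hpow, Finset.mul_sum]
    calc _ ≤ ∑ S ∈ (Finset.range B).powerset,
          Real.exp (bsum φ (Finset.Ico 0 ((L * B : ℕ) : ℤ)) (x S)) := by
          refine Finset.sum_le_sum fun S hS => ?_
          rw [← Real.exp_nat_mul, ← Real.exp_add, Real.exp_le_exp]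
          have h1 := ho.abs_bsum_sub_le_card (Finset.Ico 0 ((L * B : ℕ) : ℤ))
            (S.image fun s : ℕ => (L : ℤ) * s) (x := x S) (y := 0) fun i hi => by
              by_contra hne
              obtain ⟨s, hs, rfl⟩ := (hx S i).1 hne
              exact hi (Finset.mem_image_of_mem _ hs)
          have h2 : ((S.image fun s : ℕ => (L : ℤ) * s).card : ℝ) ≤ S.card := by
            exact_mod_cast Finset.card_image_le
          have h3 : K * ((S.image fun s : ℕ => (L : ℤ) * s).card : ℝ) ≤ K * S.card :=
            mul_le_mul_of_nonneg_left h2 (tsum_nonneg ho.nonneg)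
          rw [bsum_zero_point, Int.card_Ico, ← hK] at h1
          simp only [sub_zero, Int.toNat_natCast] at h1
          have := (abs_le.1 h1).1
          linarith
      _ = ∑ y ∈ (Finset.range B).powerset.image x,
          Real.exp (bsum φ (Finset.Ico 0 ((L * B : ℕ) : ℤ)) y) := by
          rw [Finset.sum_image hinj]
      _ ≤ _ := by
          refine Finset.sum_le_sum_of_subset_of_nonneg (fun y hy => ?_) fun _ _ _ => by positivity
          obtain ⟨S, hS, rfl⟩ := Finset.mem_image.1 hy
          refine mem_words.2 fun i hi => ?_
          by_contra hne
          obtain ⟨s, hs, rfl⟩ := (hx S i).1 hne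
          have hsB := Finset.mem_range.1 (Finset.mem_powerset.1 hS hs)
          refine hi (Finset.mem_Ico.2 ⟨by positivity, ?_⟩)
          push_cast
          have : (s : ℤ) < B := by exact_mod_cast hsB
          have hL' : (0 : ℤ) < L := by exact_mod_cast hL
          exact mul_lt_mul_of_pos_left this hL'
  set κ := Real.log (1 + Real.exp (-K)) with hκ
  have hκ0 : 0 < κ := Real.log_pos (by linarith [Real.exp_pos (-K)])
  by_contra! hle
  have hev := ho.log_windowZ_le_eventually (ε := κ / (2 * L)) (by positivity)
  have hmul : Tendsto (fun B : ℕ => L * B) atTop atTop :=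
    tendsto_id.const_mul_atTop' hL
  obtain ⟨B, hB, hB0⟩ := ((hmul.eventually hev).and (eventually_gt_atTop 0)).exists
  have h1 := (hcount B).trans hB
  have hB0' : (0 : ℝ) < B := by exact_mod_cast hB0
  push_cast at h1
  have e : (L : ℝ) * B * (pressure φ + κ / (2 * L)) = L * B * pressure φ + B * κ / 2 := by
    field_simp
  rw [e] at h1
  have := mul_le_mul_of_nonneg_left hle (mul_pos hLR hB0').le
  nlinarith

end Partition

/-! ### The Gibbs variational inequality on finite sets. -/

section GibbsInequality

/-- Nonnegativity of the relative entropy of `p` with respect to the weights `e^{F i} / S`, term by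
term from `log t ≤ t - 1`. -/
theorem sum_negMulLog_add_le_log_sum_exp {ι : Type*} [Fintype ι] (p F : ι → ℝ) (hp : ∀ i, 0 ≤ p i)
    (h1 : ∑ i, p i = 1) :
    ∑ i, Real.negMulLog (p i) + ∑ i, p i * F i ≤ Real.log (∑ i, Real.exp (F i)) := by
  have hne : Nonempty ι := by
    by_contra h
    rw [not_nonempty_iff] at h
    simp at h1
  set S := ∑ i, Real.exp (F i) with hS
  have hS0 : 0 < S := Finset.sum_pos (fun _ _ => Real.exp_pos _) Finset.univ_nonempty
  have key : ∀ i, Real.negMulLog (p i) + p i * F i - p i * Real.log S ≤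
      Real.exp (F i) / S - p i := by
    intro i
    rcases (hp i).eq_or_lt with h | h
    · rw [← h]; simp; positivity
    · have h2 := Real.log_le_sub_one_of_pos (x := Real.exp (F i) / S / p i) (by positivity)
      rw [Real.log_div (by positivity) h.ne', Real.log_div (Real.exp_pos _).ne' hS0.ne',
        Real.log_exp] at h2
      have h3 := mul_le_mul_of_nonneg_left h2 h.le
      have h4 : p i * (Real.exp (F i) / S / p i - 1) = Real.exp (F i) / S - p i := by
        field_simp
      rw [h4] at h3
      rw [Real.negMulLog]
      linarith
  have := Finset.sum_le_sum fun i (_ : i ∈ Finset.univ) => key i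
  rw [Finset.sum_sub_distrib, Finset.sum_sub_distrib, Finset.sum_add_distrib, ← Finset.sum_mul,
    ← Finset.sum_div, h1, ← hS, div_self hS0.ne'] at this
  linarith

theorem negMulLog_sum_le {ι : Type*} (s : Finset ι) (p : ι → ℝ) (hp : ∀ i, 0 ≤ p i) :
    Real.negMulLog (∑ i ∈ s, p i) ≤ ∑ i ∈ s, Real.negMulLog (p i) := by
  rw [Real.negMulLog, neg_mul, Finset.sum_mul, ← Finset.sum_neg_distrib]
  refine Finset.sum_le_sum fun i hi => ?_
  rcases (hp i).eq_or_lt with h | h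
  · simp [← h]
  · have := Real.log_le_log h (Finset.single_le_sum (f := p) (fun j _ => hp j) hi)
    rw [Real.negMulLog, neg_mul, neg_le_neg_iff]
    exact mul_le_mul_of_nonneg_left this h.le

variable {Ω : Type*} [MeasurableSpace Ω] (ν : Measure Ω) [IsProbabilityMeasure ν]

theorem integrable_comp_of_finite {ι : Type*} [Finite ι] [MeasurableSpace ι]
    [MeasurableSingletonClass ι] {C : Ω → ι} (hC : Measurable C) (F : ι → ℝ) :
    Integrable (fun ω => F (C ω)) ν := by
  have := Measure.isProbabilityMeasure_map (μ := ν) hC.aemeasurable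
  exact (Integrable.of_finite (f := F) (μ := ν.map C)).comp_measurable hC

theorem integral_comp_of_fintype {ι : Type*} [Fintype ι] [MeasurableSpace ι]
    [MeasurableSingletonClass ι] {C : Ω → ι} (hC : Measurable C) (F : ι → ℝ) :
    ∫ ω, F (C ω) ∂ν = ∑ i, ν.real (C ⁻¹' {i}) * F i := by
  have := Measure.isProbabilityMeasure_map (μ := ν) hC.aemeasurable
  rw [← integral_map hC.aemeasurable (measurable_of_finite F).aestronglyMeasurable,
    integral_fintype Integrable.of_finite]
  refine Finset.sum_congr rfl fun i _ => ?_
  rw [map_measureReal_apply hC (measurableSet_singleton i), smul_eq_mul]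

/-- The entropy of `A` plus the mean of `F(A, B)` is at most the log-partition function of `F`. -/
theorem sum_negMulLog_add_integral_le {α γ : Type*} [Fintype α] [Fintype γ] [MeasurableSpace α]
    [MeasurableSpace γ] [MeasurableSingletonClass α] [MeasurableSingletonClass γ] {A : Ω → α}
    {B : Ω → γ} (hA : Measurable A) (hB : Measurable B) (F : α → γ → ℝ) :
    ∑ u, Real.negMulLog (ν.real (A ⁻¹' {u})) + ∫ ω, F (A ω) (B ω) ∂ν ≤
      Real.log (∑ u, ∑ y, Real.exp (F u y)) := by
  let C : Ω → α × γ := fun ω => (A ω, B ω)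
  have hC : Measurable C := hA.prodMk hB
  have hmarg : ∀ u, ν.real (A ⁻¹' {u}) = ∑ y, ν.real (C ⁻¹' {(u, y)}) := by
    intro u
    rw [← measureReal_biUnion_finset]
    · congr 1
      ext ω
      simp [C]
    · intro y _ y' _ hyy'
      refine Set.disjoint_left.2 fun ω h1 h2 => hyy' ?_
      simp only [C, mem_preimage, mem_singleton_iff, Prod.mk.injEq] at h1 h2
      exact h1.2.symm.trans h2.2
    · exact fun y _ => hC (measurableSet_singleton _)
  have hint : ∫ ω, F (A ω) (B ω) ∂ν = ∑ i, ν.real (C ⁻¹' {i}) * F i.1 i.2 :=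
    integral_comp_of_fintype ν hC fun i => F i.1 i.2
  have hone : ∑ i, ν.real (C ⁻¹' {i}) = 1 := by
    have := integral_comp_of_fintype ν hC fun _ => (1 : ℝ)
    simpa using this.symm
  have h := sum_negMulLog_add_le_log_sum_exp (fun i => ν.real (C ⁻¹' {i}))
    (fun i => F i.1 i.2) (fun _ => measureReal_nonneg) hone
  rw [Fintype.sum_prod_type (f := fun i : α × γ => Real.exp (F i.1 i.2)),
    Fintype.sum_prod_type (f := fun i : α × γ => Real.negMulLog (ν.real (C ⁻¹' {i})))] at h
  rw [hint]
  refine le_trans (add_le_add_left (Finset.sum_le_sum fun u _ => ?_) _) h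
  rw [hmarg]
  exact negMulLog_sum_le _ _ fun _ => measureReal_nonneg

end GibbsInequality

/-! ### Invariant measures and approximation of partitions by cylinders. -/

section Invariance

variable {β : ℝ}

theorem continuous_shift (j : ℤ) : Continuous (shift (β := β) j) :=
  continuous_induced_rng.2 (continuous_pi fun i =>
    (continuous_apply (i + j)).comp continuous_subtype_val)

theorem measurable_shift (j : ℤ) : Measurable (shift (β := β) j) := (continuous_shift j).measurable

theorem continuous_trunc [Fact (1 < β)] (I : Finset ℤ) : Continuous (trunc (β := β) I) := by
  refine Continuous.subtype_mk (continuous_pi fun i => ?_) _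
  split_ifs
  · exact (continuous_apply i).comp continuous_subtype_val
  · exact continuous_const

theorem IsInvariantProb.measurePreserving {ν : Measure (twoSided β)} (hν : IsInvariantProb ν)
    (n : ℕ) : MeasurePreserving (shift (β := β) n) ν ν := by
  have := hν.2.iterate n
  rwa [show (shift (β := β) 1)^[n] = shift n from funext fun x => shift_iterate n x] at this

theorem IsInvariantProb.measureReal_preimage {ν : Measure (twoSided β)} (hν : IsInvariantProb ν)
    (n : ℕ) {S : Set (twoSided β)} (hS : MeasurableSet S) :
    ν.real (shift (n : ℤ) ⁻¹' S) = ν.real S := by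
  rw [measureReal_def, measureReal_def,
    (hν.measurePreserving n).measure_preimage hS.nullMeasurableSet]

variable [hβ : Fact (1 < β)]

/-- Truncation to the window `[0, m)`, with values in the finite set of words. -/
def truncWord (m : ℕ) (x : twoSided β) : words β m := ⟨trunc (Finset.Ico 0 (m : ℤ)) x, trunc_mem_words m x⟩

theorem measurable_truncWord (m : ℕ) : Measurable (truncWord (β := β) m) :=
  (continuous_trunc _).measurable.subtype_mk

theorem measurable_comp_trunc {γ : Type*} [MeasurableSpace γ] (m : ℕ) (f : twoSided β → γ) :
    Measurable fun x => f (trunc (Finset.Ico 0 (m : ℤ)) x) :=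
  (measurable_of_finite fun y : words β m => f y).comp (measurable_truncWord m)

theorem tendsto_trunc (x : twoSided β) :
    Tendsto (fun R : ℕ => trunc (Finset.Icc (-R : ℤ) R) x) atTop (𝓝 x) := by
  rw [tendsto_subtype_rng, tendsto_pi_nhds]
  intro i
  refine tendsto_const_nhds.congr' ?_
  filter_upwards [eventually_ge_atTop i.natAbs] with R hR
  exact (trunc_apply_of_mem x (Finset.mem_Icc.2 (by omega))).symm

/-- A finite measurable partition is approximated by partitions into cylinders. -/
theorem IsInvariantProb.exists_window_approx {ν : Measure (twoSided β)} (hν : IsInvariantProb ν)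
    {k : ℕ} {ξ : twoSided β → Fin k} (hξ : Measurable ξ) {δ : ℝ} (hδ : 0 < δ) :
    ∃ (R M : ℕ) (ζ : twoSided β → Fin k),
      (∀ x, ζ (trunc (Finset.Ico 0 (M : ℤ)) x) = ζ x) ∧
      ν.real {x | ξ (shift R x) ≠ ζ x} ≤ δ := by
  classical
  have := hν.1
  have hk : 0 < k := (Nat.zero_le _).trans_lt (ξ 0).isLt
  have hξR : Measurable fun x => ((ξ x : ℕ) : ℝ) :=
    (measurable_of_finite fun i : Fin k => ((i : ℕ) : ℝ)).comp hξ
  have hξb : ∀ x, |((ξ x : ℕ) : ℝ)| ≤ k := fun x => by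
    rw [abs_of_nonneg (Nat.cast_nonneg _)]; exact_mod_cast (ξ x).isLt.le
  have hξi : Integrable (fun x => ((ξ x : ℕ) : ℝ)) ν :=
    integrable_comp_of_finite ν hξ fun i : Fin k => ((i : ℕ) : ℝ)
  -- The labels, read as real numbers, are approximated in L¹ by a continuous function, which is
  -- then evaluated at truncated points.
  obtain ⟨g, hg, -⟩ := hξi.exists_boundedContinuous_integral_sub_le (ε := δ / 4) (by positivity)
  have htend : Tendsto (fun R : ℕ => ∫ x, ‖((ξ x : ℕ) : ℝ) - g (trunc (Finset.Icc (-R : ℤ) R) x)‖ ∂ν)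
      atTop (𝓝 (∫ x, ‖((ξ x : ℕ) : ℝ) - g x‖ ∂ν)) := by
    refine tendsto_integral_of_dominated_convergence (fun _ => k + ‖g‖) (fun R => ?_)
      (integrable_const _) (fun R => ?_) ?_
    · exact (hξR.sub (g.continuous.comp (continuous_trunc _)).measurable).norm.aestronglyMeasurable
    · refine Eventually.of_forall fun x => ?_
      rw [norm_norm]
      exact (norm_sub_le _ _).trans (add_le_add (hξb x) (g.norm_coe_le_norm _))
    · refine Eventually.of_forall fun x => ?_
      exact (tendsto_const_nhds.sub ((g.continuous.tendsto x).comp (tendsto_trunc x))).norm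
  obtain ⟨R, hR⟩ := (htend.eventually_lt_const (u := δ / 2) (by linarith)).exists
  -- Rounding to a label: two labels within distance less than 1/2 of `t` coincide. A wrong label
  -- costs L¹ error at least 1/2, so Markov's inequality turns `δ / 2` into `δ`.
  let dec : ℝ → Fin k := fun t => if h : ∃ u : Fin k, |((u : ℕ) : ℝ) - t| < 1 / 2 then h.choose
    else ⟨0, hk⟩
  have hdec : ∀ (t : ℝ) (u : Fin k), |((u : ℕ) : ℝ) - t| < 1 / 2 → dec t = u := by
    intro t u hu
    have hex : ∃ u : Fin k, |((u : ℕ) : ℝ) - t| < 1 / 2 := ⟨u, hu⟩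
    have h1 : dec t = hex.choose := dif_pos hex
    have h2 := hex.choose_spec
    rw [← h1] at h2
    have h3 : |((dec t : ℕ) : ℝ) - ((u : ℕ) : ℝ)| < 1 := by
      rw [abs_lt] at *
      constructor <;> linarith
    have h4 : |((dec t : ℕ) : ℤ) - ((u : ℕ) : ℤ)| < 1 := by exact_mod_cast h3
    rw [Int.abs_lt_one_iff, sub_eq_zero] at h4
    exact Fin.ext (by exact_mod_cast h4)
  -- The shift by `R` carries the symmetric window `[-R, R]` to `[0, 2R + 1)`.
  have hcomm : ∀ x : twoSided β, shift (R : ℤ) (trunc (Finset.Ico 0 ((2 * R + 1 : ℕ) : ℤ)) x) =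
      trunc (Finset.Icc (-R : ℤ) R) (shift R x) := by
    refine fun x => ext_coord fun i => ?_
    simp only [shift_apply, trunc_apply, Finset.mem_Ico, Finset.mem_Icc]
    push_cast
    congr 1
    simp only [eq_iff_iff]
    omega
  refine ⟨R, 2 * R + 1, fun x => dec (g (shift R (trunc (Finset.Ico 0 ((2 * R + 1 : ℕ) : ℤ)) x))),
    fun x => ?_, ?_⟩
  · have : trunc (Finset.Ico 0 ((2 * R + 1 : ℕ) : ℤ)) (trunc (Finset.Ico 0 ((2 * R + 1 : ℕ) : ℤ)) x)
        = trunc (Finset.Ico 0 ((2 * R + 1 : ℕ) : ℤ)) x :=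
      ext_coord fun i => by simp only [trunc_apply]; split_ifs <;> rfl
    simp only [this]
  · let D : twoSided β → ℝ := fun z => ‖((ξ z : ℕ) : ℝ) - g (trunc (Finset.Icc (-R : ℤ) R) z)‖
    have hDm : Measurable D :=
      (hξR.sub (g.continuous.comp (continuous_trunc _)).measurable).norm
    have hDi : Integrable D ν := by
      refine Integrable.of_bound hDm.aestronglyMeasurable (k + ‖g‖) (Eventually.of_forall fun x => ?_)
      rw [norm_norm]
      exact (norm_sub_le _ _).trans (add_le_add (hξb x) (g.norm_coe_le_norm _))
    have hmarkov := mul_meas_ge_le_integral_of_nonneg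
      (Eventually.of_forall fun x => norm_nonneg _ : 0 ≤ᵐ[ν] D) hDi (1 / 2)
    have hsub : {x | ξ (shift R x) ≠ dec (g (shift R
        (trunc (Finset.Ico 0 ((2 * R + 1 : ℕ) : ℤ)) x)))} ⊆ shift (R : ℤ) ⁻¹' {z | 1 / 2 ≤ D z} := by
      intro x hx
      by_contra hlt
      simp only [mem_preimage, Set.mem_ofPred_eq, not_le] at hlt
      refine hx (hdec _ _ ?_).symm
      rw [hcomm]
      exact hlt
    have h1 := measureReal_mono (μ := ν) hsub
    rw [hν.measureReal_preimage R (measurableSet_le measurable_const hDm)] at h1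
    linarith

theorem OscBound.integrable {φ : C(twoSided β, ℝ)} {o : ℤ → ℝ} (ho : OscBound φ o)
    {ν : Measure (twoSided β)} [IsProbabilityMeasure ν] : Integrable φ ν :=
  Integrable.of_bound φ.continuous.measurable.aestronglyMeasurable _ (Eventually.of_forall ho.abs_apply_le)

theorem OscBound.integral_bsum {φ : C(twoSided β, ℝ)} {o : ℤ → ℝ} (ho : OscBound φ o)
    {ν : Measure (twoSided β)} (hν : IsInvariantProb ν) (m : ℕ) :
    Integrable (bsum φ (Finset.Ico 0 (m : ℤ))) ν ∧
      ∫ x, bsum φ (Finset.Ico 0 (m : ℤ)) x ∂ν = m * ∫ x, φ x ∂ν := by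
  have := hν.1
  have hi : ∀ n : ℕ, Integrable (fun x => φ (shift n x)) ν := fun n =>
    (hν.measurePreserving n).integrable_comp_of_integrable ho.integrable
  have hsum : bsum φ (Finset.Ico 0 (m : ℤ)) = fun x => ∑ l ∈ Finset.range m, φ (shift (l : ℤ) x) :=
    funext fun x => (bsum_range φ m x).symm
  rw [hsum]
  refine ⟨integrable_finsetSum _ fun n _ => hi n, ?_⟩
  rw [integral_finsetSum _ fun n _ => hi n]
  have : ∀ n : ℕ, ∫ x, φ (shift n x) ∂ν = ∫ x, φ x ∂ν := by
    intro n
    have h := (hν.measurePreserving n)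
    conv_rhs => rw [← h.map_eq]
    rw [integral_map h.aemeasurable φ.continuous.measurable.aestronglyMeasurable]
  simp [this]

end Invariance

/-! ### Equilibrium measures as near-maximizers of the finite-volume free energy. -/

section Equilibrium

variable {β : ℝ} [hβ : Fact (1 < β)] {φ : C(twoSided β, ℝ)} {o : ℤ → ℝ}
  {ν : Measure (twoSided β)}

theorem IsEquilibrium.exists_partition {β : ℝ} {φ : C(twoSided β, ℝ)}
    {ν : Measure (twoSided β)} (hν : IsEquilibrium φ ν) {ε : ℝ} (hε : 0 < ε) :
    ∃ (k : ℕ) (ξ : twoSided β → Fin k), Measurable ξ ∧ ∃ᶠ n : ℕ in atTop,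
      pressure φ - ∫ x, φ x ∂ν - ε < joinEntropy ν (shift 1) ξ n / n := by
  have hlt : ((pressure φ - ∫ x, φ x ∂ν - ε : ℝ) : EReal) < entropy ν (shift (β := β) 1) := by
    by_contra! hle
    have h1 := add_le_add_left hle ((∫ x, φ x ∂ν : ℝ) : EReal)
    rw [← hν.2, ← EReal.coe_add, EReal.coe_le_coe_iff] at h1
    linarith
  simp only [entropy, lt_iSup_iff] at hlt
  obtain ⟨k, ξ, hξ, hlt⟩ := hlt
  refine ⟨k, ξ, hξ, (frequently_lt_of_lt_limsup (by isBoundedDefault) hlt).mono fun n hn => ?_⟩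
  exact EReal.coe_lt_coe_iff.1 hn

/-- The weight factorizes over sites. For large `l` the bound is close to 1 per site, so summing
over label sequences costs little once disagreements with `v` are penalized. -/
theorem sum_exp_sub_mismatch_le {k n : ℕ} (l : ℝ) (v : Fin n → Fin k) :
    ∑ u : Fin n → Fin k, Real.exp (-l * ∑ i, if u i = v i then 0 else 1) ≤
      (1 + k * Real.exp (-l)) ^ n := by
  have h1 : ∀ u : Fin n → Fin k, Real.exp (-l * ∑ i, if u i = v i then 0 else 1) =
      ∏ i, Real.exp (-l * if u i = v i then 0 else 1) := fun u => by
    rw [Finset.mul_sum, Real.exp_sum]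
  simp only [h1]
  rw [← Fintype.prod_sum fun i (a : Fin k) => Real.exp (-l * if a = v i then 0 else 1)]
  have h2 : ∀ i, ∑ a : Fin k, Real.exp (-l * if a = v i then 0 else 1) ≤
      1 + k * Real.exp (-l) := by
    intro i
    calc _ ≤ ∑ a : Fin k, ((if a = v i then 1 else 0) + Real.exp (-l)) := by
          refine Finset.sum_le_sum fun a _ => ?_
          split_ifs
          · simp [(Real.exp_pos _).le]
          · simp
      _ = _ := by simp [Finset.sum_add_distrib]
  calc _ ≤ ∏ _i : Fin n, (1 + k * Real.exp (-l)) :=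
        Finset.prod_le_prod (fun i _ => Finset.sum_nonneg fun _ _ => (Real.exp_pos _).le)
          fun i _ => h2 i
    _ = _ := by simp

/-- An equilibrium measure nearly maximizes the finite-volume free energy: the mean of any function
of the window is bounded by the change of the log-partition function it produces. -/
theorem IsEquilibrium.frequently_integral_le (hν : IsEquilibrium φ ν) (ho : OscBound φ o) {ε : ℝ}
    (hε : 0 < ε) : ∃ᶠ m : ℕ in atTop, ∀ f : twoSided β → ℝ,
      ∫ x, f (trunc (Finset.Ico 0 (m : ℤ)) x) ∂ν ≤
        Real.log (∑ y ∈ words β m, Real.exp (bsum φ (Finset.Ico 0 (m : ℤ)) y + f y))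
          - m * pressure φ + ε * m := by
  classical
  have hinv := hν.1
  have := hinv.1
  set h := pressure φ - ∫ x, φ x ∂ν with hh
  obtain ⟨k, ξ, hξ, hfreq⟩ := hν.exists_partition (ε := ε / 8) (by positivity)
  -- `l` is large enough that the sum over label sequences costs at most `ε / 8` per site. The
  -- approximation below is then chosen with mismatch frequency `ε / (8 * l)`, so that the mean
  -- penalty is also at most `ε / 8` per site.
  obtain ⟨l, hl0, hl⟩ : ∃ l : ℝ, 0 < l ∧ k * Real.exp (-l) ≤ ε / 8 := by
    have ht : Tendsto (fun l : ℝ => k * Real.exp (-l)) atTop (𝓝 (k * 0)) :=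
      (Real.tendsto_exp_neg_atTop_nhds_zero).const_mul _
    rw [mul_zero] at ht
    obtain ⟨l, h1, h2⟩ := ((ht.eventually_lt_const (u := ε / 8) (by positivity)).and
      (eventually_gt_atTop 0)).exists
    exact ⟨l, h2, h1.le⟩
  obtain ⟨R, M, ζ, hζ, hδ⟩ := hinv.exists_window_approx hξ (δ := ε / (8 * l)) (by positivity)
  have hlarge : ∀ᶠ n : ℕ in atTop, |h| * M ≤ ε / 8 * n :=
    ((tendsto_natCast_atTop_atTop (R := ℝ)).eventually_ge_atTop (|h| * M / (ε / 8))).mono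
      fun n hn => by rwa [div_le_iff₀' (by positivity)] at hn
  have hb := (tendsto_add_atTop_nat M).eventually
    (bdry_le_eventually ho.nonneg ho.summable (ε := ε / 8) (by positivity))
  refine (tendsto_add_atTop_nat M).frequently
    ((hfreq.and_eventually ((hlarge.and hb).and (eventually_gt_atTop 0))).mono ?_)
  rintro n ⟨hn, ⟨hnl, hnb⟩, hn0⟩ f
  -- A window of this length determines `ζ` along the first `n` shifts.
  set m := n + M with hm
  have hn0R : (0 : ℝ) < n := by exact_mod_cast hn0
  rw [lt_div_iff₀ hn0R] at hn
  -- `ζ` approximates `ξ ∘ shift R`; by invariance the extra shift leaves the entropy unchanged.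
  let A : twoSided β → Fin n → Fin k := fun x i => ξ (shift (i : ℤ) (shift R x))
  have hA : Measurable A := measurable_pi_lambda _ fun i =>
    hξ.comp ((measurable_shift _).comp (measurable_shift _))
  let v : twoSided β → Fin n → Fin k := fun y i => ζ (shift (i : ℤ) y)
  let F : (Fin n → Fin k) → words β m → ℝ := fun u y =>
    (bsum φ (Finset.Ico 0 (m : ℤ)) y + f y) + -l * ∑ i, if u i = v y i then 0 else 1
  have hG := sum_negMulLog_add_integral_le ν hA (measurable_truncWord m) F
  have hent : ∑ u, Real.negMulLog (ν.real (A ⁻¹' {u})) = joinEntropy ν (shift 1) ξ n := by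
    rw [joinEntropy]
    refine Finset.sum_congr rfl fun u _ => ?_
    congr 1
    have hS : MeasurableSet {x | ∀ i : Fin n, ξ ((shift 1)^[i] x) = u i} := by
      simp only [shift_iterate]
      have e : {x | ∀ i : Fin n, ξ (shift (i : ℤ) x) = u i} =
          ⋂ i : Fin n, (ξ ∘ shift (i : ℤ)) ⁻¹' {u i} := by
        ext x; simp
      rw [e]
      exact MeasurableSet.iInter fun i =>
        (hξ.comp (measurable_shift _)) (measurableSet_singleton (u i))
    rw [← hinv.measureReal_preimage R hS]
    congr 1
    ext x
    simp only [A, shift_iterate, mem_preimage, mem_singleton_iff, funext_iff, Set.mem_ofPred_eq]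
  have hsum : Real.log (∑ u, ∑ y, Real.exp (F u y)) ≤
      Real.log (∑ y ∈ words β m, Real.exp (bsum φ (Finset.Ico 0 (m : ℤ)) y + f y))
        + ε / 8 * n := by
    have hZ : 0 < ∑ y ∈ words β m, Real.exp (bsum φ (Finset.Ico 0 (m : ℤ)) y + f y) :=
      Finset.sum_pos (fun _ _ => Real.exp_pos _) ⟨0, zero_mem_words m⟩
    have hk : 0 < k := (Nat.zero_le _).trans_lt (ξ 0).isLt
    have hle : ∑ u, ∑ y, Real.exp (F u y) ≤
        (∑ y ∈ words β m, Real.exp (bsum φ (Finset.Ico 0 (m : ℤ)) y + f y)) *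
          (1 + k * Real.exp (-l)) ^ n := by
      rw [Finset.sum_comm, ← Finset.sum_coe_sort (words β m), Finset.sum_mul]
      refine Finset.sum_le_sum fun y _ => ?_
      simp only [F, Real.exp_add (_ + _)]
      rw [← Finset.mul_sum]
      exact mul_le_mul_of_nonneg_left (sum_exp_sub_mismatch_le l (v y)) (Real.exp_pos _).le
    have hpos : 0 < ∑ u, ∑ y, Real.exp (F u y) := by
      have : Nonempty (Fin n → Fin k) := ⟨A 0⟩
      have : Nonempty (words β m) := ⟨⟨0, zero_mem_words m⟩⟩
      exact Finset.sum_pos (fun _ _ => Finset.sum_pos (fun _ _ => Real.exp_pos _)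
        Finset.univ_nonempty) Finset.univ_nonempty
    refine (Real.log_le_log hpos hle).trans ?_
    rw [Real.log_mul hZ.ne' (by positivity), Real.log_pow]
    have h1 := Real.log_le_sub_one_of_pos (x := 1 + k * Real.exp (-l)) (by positivity)
    have h2 : Real.log (1 + k * Real.exp (-l)) ≤ ε / 8 := by linarith
    nlinarith
  have hint : ∫ x, F (A x) (truncWord m x) ∂ν =
      ∫ x, bsum φ (Finset.Ico 0 (m : ℤ)) (trunc (Finset.Ico 0 (m : ℤ)) x) ∂ν
        + ∫ x, f (trunc (Finset.Ico 0 (m : ℤ)) x) ∂ν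
        + -l * ∑ i : Fin n, ∫ x, (if A x i = v (trunc (Finset.Ico 0 (m : ℤ)) x) i then (0 : ℝ) else 1) ∂ν := by
    have i1 : Integrable (fun x => bsum φ (Finset.Ico 0 (m : ℤ)) (trunc (Finset.Ico 0 (m : ℤ)) x)) ν :=
      integrable_comp_of_finite ν (measurable_truncWord m)
        fun y => bsum φ (Finset.Ico 0 (m : ℤ)) y.1
    have i2 : Integrable (fun x => f (trunc (Finset.Ico 0 (m : ℤ)) x)) ν :=
      integrable_comp_of_finite ν (measurable_truncWord m) fun y => f y.1
    have i3 : ∀ i : Fin n, Integrable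
        (fun x => if A x i = v (trunc (Finset.Ico 0 (m : ℤ)) x) i then (0 : ℝ) else 1) ν := fun i =>
      integrable_comp_of_finite ν (hA.prodMk (measurable_truncWord m))
        fun p => if p.1 i = v p.2 i then (0 : ℝ) else 1
    have i12 : Integrable (fun x => bsum φ (Finset.Ico 0 (m : ℤ)) (trunc (Finset.Ico 0 (m : ℤ)) x)
        + f (trunc (Finset.Ico 0 (m : ℤ)) x)) ν := i1.add i2
    rw [← integral_finsetSum _ fun i _ => i3 i, ← integral_const_mul, ← integral_add i1 i2,
      ← integral_add i12 ((integrable_finsetSum _ fun i _ => i3 i).const_mul _)]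
    rfl
  have hmis : ∀ i : Fin n, ∫ x, (if A x i = v (trunc (Finset.Ico 0 (m : ℤ)) x) i then (0 : ℝ) else 1) ∂ν
      ≤ ε / (8 * l) := by
    intro i
    refine le_trans (le_of_eq ?_) hδ
    have hζm : Measurable ζ := by
      have := measurable_comp_trunc M ζ
      simpa only [hζ] using this
    have hS : MeasurableSet {x | ξ (shift R x) ≠ ζ x} :=
      (measurableSet_eq_fun (hξ.comp (measurable_shift _)) hζm).compl
    rw [← hinv.measureReal_preimage i hS, ← integral_indicator_one ((measurable_shift _) hS)]
    refine integral_congr_ae (Eventually.of_forall fun x => ?_)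
    have e1 : v (trunc (Finset.Ico 0 (m : ℤ)) x) i = ζ (shift (i : ℤ) x) := by
      simp only [v]
      rw [← hζ (shift _ (trunc _ x)), ← hζ (shift _ x)]
      congr 1
      refine ext_coord fun j => ?_
      simp only [trunc_apply, shift_apply, Finset.mem_Ico]
      have := i.isLt
      split_ifs with h1 h2
      · rfl
      · omega
      · rfl
    have e2 : A x i = ξ (shift R (shift (i : ℤ) x)) := by
      simp only [A, shift_shift, add_comm]
    simp only [e1, e2, indicator, mem_preimage, Set.mem_ofPred_eq, Pi.one_apply]
    split_ifs <;> simp_all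
  have hbs : m * ∫ x, φ x ∂ν - bdry o m ≤
      ∫ x, bsum φ (Finset.Ico 0 (m : ℤ)) (trunc (Finset.Ico 0 (m : ℤ)) x) ∂ν := by
    obtain ⟨i1, e1⟩ := ho.integral_bsum hinv m
    rw [← e1, sub_le_iff_le_add]
    have i2 : Integrable (fun x => bsum φ (Finset.Ico 0 (m : ℤ)) (trunc (Finset.Ico 0 (m : ℤ)) x)) ν :=
      integrable_comp_of_finite ν (measurable_truncWord m)
        fun y => bsum φ (Finset.Ico 0 (m : ℤ)) y.1
    have : ∫ x, (bsum φ (Finset.Ico 0 (m : ℤ)) (trunc (Finset.Ico 0 (m : ℤ)) x) + bdry o m) ∂ν =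
        ∫ x, bsum φ (Finset.Ico 0 (m : ℤ)) (trunc (Finset.Ico 0 (m : ℤ)) x) ∂ν + bdry o m := by
      rw [integral_add i2 (integrable_const _)]; simp
    rw [← this]
    refine integral_mono i1 (i2.add (integrable_const _)) fun x => ?_
    have := ho.abs_bsum_sub_le_of_eq_on (a := 0) (N := m) (J := Finset.Ico 0 (m : ℤ)) (by simp)
      (x := x) (y := trunc (Finset.Ico 0 (m : ℤ)) x) fun i hi =>
        (trunc_apply_of_mem x (by simpa using hi)).symm
    have := (abs_le.1 this).2
    linarith
  have hmis' : l * ∑ i : Fin n, ∫ x, (if A x i = v (trunc (Finset.Ico 0 (m : ℤ)) x) i then (0 : ℝ) else 1) ∂ν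
      ≤ ε / 8 * n := by
    have h1 := Finset.sum_le_sum fun i (_ : i ∈ Finset.univ) => hmis i
    rw [Finset.sum_const, Finset.card_univ, Fintype.card_fin, nsmul_eq_mul] at h1
    calc _ ≤ l * (n * (ε / (8 * l))) := mul_le_mul_of_nonneg_left h1 hl0.le
      _ = _ := by field_simp
  rw [hent, hint] at hG
  have hMh : (M : ℝ) * h ≤ ε / 8 * n := by
    have h1 := le_abs_self h
    have h2 : (0 : ℝ) ≤ M := Nat.cast_nonneg _
    nlinarith
  have hmR : (m : ℝ) = n + M := by rw [hm]; push_cast; rfl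
  have hMε : 0 ≤ ε * M := by positivity
  have hP : pressure φ = h + ∫ x, φ x ∂ν := by rw [hh]; ring
  have hmP : (m : ℝ) * pressure φ = n * h + M * h + m * ∫ x, φ x ∂ν := by rw [hP, hmR]; ring
  have hεm : ε * (m : ℝ) = ε * n + ε * M := by rw [hmR]; ring
  have hbm : ε / 8 * (m : ℝ) = ε / 8 * n + ε / 8 * M := by rw [hmR]; ring
  rw [hmP, hεm]
  rw [hbm] at hnb
  have hεn : 0 < ε * n := by positivity
  linarith

end Equilibrium

/-! ### Replacing words, and the resulting comparison of cylinder measures. -/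

section Replacement

variable {β : ℝ}

theorem mem_cylinder_iff {m : ℕ} {x y : twoSided β} :
    y ∈ cylinder m x ↔ ∀ i ∈ Finset.Ico (0 : ℤ) m, y.1 i = x.1 i := by
  refine ⟨fun h i hi => ?_, fun h i hi => h i (Finset.mem_Ico.2 (by omega))⟩
  rw [Finset.mem_Ico] at hi
  obtain ⟨j, rfl⟩ := Int.eq_ofNat_of_zero_le hi.1
  exact h j (by omega)

theorem self_mem_cylinder (m : ℕ) (x : twoSided β) : x ∈ cylinder m x := fun _ _ => rfl

variable [hβ : Fact (1 < β)]

theorem cylinder_eq_preimage (m : ℕ) (x : twoSided β) :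
    cylinder m x = truncWord m ⁻¹' {truncWord m x} := by
  ext y
  rw [mem_cylinder_iff, mem_preimage, mem_singleton_iff]
  constructor
  · refine fun h => Subtype.ext (eq_of_mem_words (m := m) (Subtype.coe_prop _) (Subtype.coe_prop _)
      fun i hi => ?_)
    simp only [truncWord, trunc_apply_of_mem _ hi]
    exact h i hi
  · intro h i hi
    have := congrFun (congrArg (fun w => (w : words β m).1.1) h) i
    simpa only [truncWord, trunc_apply_of_mem _ hi] using this

theorem measurableSet_cylinder (m : ℕ) (x : twoSided β) : MeasurableSet (cylinder m x) := by
  rw [cylinder_eq_preimage]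
  exact measurable_truncWord m (measurableSet_singleton _)

theorem trunc_mem_cylinder_iff {m n : ℕ} (h : m ≤ n) {x y : twoSided β} :
    trunc (Finset.Ico 0 (n : ℤ)) y ∈ cylinder m x ↔ y ∈ cylinder m x := by
  refine forall₂_congr fun i hi => ?_
  rw [trunc_apply_of_mem _ (Finset.mem_Ico.2 (by omega))]

variable {φ : C(twoSided β, ℝ)} {o : ℤ → ℝ} {ν : Measure (twoSided β)}

/-- Because φ(0) < p(φ), a reward `γ * m` on the zero word raises its weight only to `e^{mp}`, and
the partition function stays below `2 e^{m(p+ε)}`. Hence `γ * m * ν[0^m] ≤ log 2 + 2 * ε * m`. -/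
theorem IsEquilibrium.exists_cylinder_zero_le (hν : IsEquilibrium φ ν) (ho : OscBound φ o) {η : ℝ}
    (hη : 0 < η) : ∃ m : ℕ, ν.real (cylinder m 0) ≤ η := by
  classical
  have := hν.1.1
  set γ := pressure φ - φ 0 with hγ
  have hγ0 : 0 < γ := sub_pos.2 ho.apply_zero_lt_pressure
  set ε := η * γ / 4 with hε
  have hε0 : 0 < ε := by positivity
  obtain ⟨m, ⟨hm, hZ⟩, hlarge⟩ := (((hν.frequently_integral_le ho hε0).and_eventually
    (ho.log_windowZ_le_eventually hε0)).and_eventually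
    ((tendsto_natCast_atTop_atTop (R := ℝ)).eventually_gt_atTop (2 * Real.log 2 / (η * γ)))).exists
  rw [div_lt_iff₀ (by positivity)] at hlarge
  have h1 := hm fun y => (cylinder m 0).indicator (fun _ => γ * m) y
  have h2 : ∫ x, (cylinder m 0).indicator (fun _ => γ * m) (trunc (Finset.Ico 0 (m : ℤ)) x) ∂ν =
      ν.real (cylinder m 0) * (γ * m) := by
    have : (fun x => (cylinder m 0).indicator (fun _ => γ * m) (trunc (Finset.Ico 0 (m : ℤ)) x)) =
        (cylinder m (0 : twoSided β)).indicator (fun _ => γ * m) := by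
      funext x
      simp only [indicator, trunc_mem_cylinder_iff le_rfl]
    rw [this, integral_indicator_const _ (measurableSet_cylinder m 0), smul_eq_mul]
  rw [h2] at h1
  have h3 : ∑ y ∈ words β m, Real.exp (bsum φ (Finset.Ico 0 (m : ℤ)) y
      + (cylinder m 0).indicator (fun _ => γ * m) y) ≤ 2 * Real.exp (m * (pressure φ + ε)) := by
    calc _ ≤ ∑ y ∈ words β m, (Real.exp (bsum φ (Finset.Ico 0 (m : ℤ)) y)
          + if y = 0 then Real.exp (m * pressure φ) else 0) := by
          refine Finset.sum_le_sum fun y hy => ?_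
          by_cases h0 : y = 0
          · subst h0
            rw [if_pos rfl, indicator_of_mem (self_mem_cylinder m 0)]
            refine le_add_of_nonneg_of_le (Real.exp_pos _).le (Real.exp_le_exp.2 (le_of_eq ?_))
            simp only [bsum_zero_point, Int.card_Ico, sub_zero, Int.toNat_natCast, hγ]
            ring
          · rw [if_neg h0, indicator_of_notMem, add_zero, add_zero]
            intro hc
            exact h0 (eq_of_mem_words hy (zero_mem_words m) (mem_cylinder_iff.1 hc))
      _ = windowZ φ m + Real.exp (m * pressure φ) := by
          rw [Finset.sum_add_distrib, Finset.sum_ite_eq' _ _ _, if_pos (zero_mem_words m), windowZ]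
      _ ≤ _ := by
          rw [two_mul]
          refine add_le_add ((Real.log_le_iff_le_exp (windowZ_pos φ m)).1 hZ) (Real.exp_le_exp.2 ?_)
          have : (0 : ℝ) ≤ m := Nat.cast_nonneg m
          nlinarith
  have h4 := Real.log_le_log (Finset.sum_pos (fun _ _ => Real.exp_pos _) ⟨0, zero_mem_words m⟩) h3
  rw [Real.log_mul two_ne_zero (Real.exp_pos _).ne', Real.log_exp] at h4
  refine ⟨m, ?_⟩
  have hmpos : (0 : ℝ) < m := by
    have : 0 ≤ Real.log 2 := Real.log_nonneg (by norm_num)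
    by_contra! hneg
    nlinarith [mul_pos hη hγ0]
  have h5 : ν.real (cylinder m 0) * (γ * m) ≤ η * (γ * m) := by
    have e : ε * m = η * γ * m / 4 := by rw [hε]; ring
    nlinarith
  exact le_of_mul_le_mul_right h5 (by positivity)

/-- Otherwise, by invariance, every cylinder of zeros would have full measure. -/
theorem IsEquilibrium.measureReal_ne_zero_pos (hν : IsEquilibrium φ ν) (ho : OscBound φ o) :
    0 < ν.real {x | x.1 0 ≠ 0} := by
  have := hν.1.1
  obtain ⟨m, hm⟩ := hν.exists_cylinder_zero_le ho (η := 1 / 2) (by norm_num)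
  refine measureReal_nonneg.lt_of_ne fun h => ?_
  have hS : MeasurableSet {x : twoSided β | x.1 0 ≠ 0} :=
    (measurableSet_eq_fun ((measurable_pi_apply 0).comp measurable_subtype_coe)
      measurable_const).compl
  have hcov : (univ : Set (twoSided β)) ⊆
      cylinder m 0 ∪ ⋃ i ∈ Finset.range m, shift (i : ℤ) ⁻¹' {x | x.1 0 ≠ 0} := by
    intro x _
    by_cases hx : x ∈ cylinder m 0
    · exact Or.inl hx
    · refine Or.inr ?_
      simp only [cylinder, Set.mem_ofPred_eq] at hx
      push Not at hx
      obtain ⟨i, hi, hne⟩ := hx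
      simp only [mem_iUnion]
      exact ⟨i, Finset.mem_range.2 hi, by simpa using hne⟩
  have h1 := (measureReal_mono (μ := ν) hcov).trans ((measureReal_union_le _ _).trans
    (add_le_add le_rfl (measureReal_biUnion_finset_le _ _)))
  simp only [hν.1.measureReal_preimage _ hS, ← h, Finset.sum_const_zero, probReal_univ] at h1
  linarith

/-- Replacing the word of `u` by that of `v` at the sites `[a, a + m)` in a larger window. -/
theorem OscBound.sum_replace_le (ho : OscBound φ o) {m : ℕ} {u v : twoSided β}
    (hrep : ∀ x ∈ cylinder m u, patch 0 m v.1 x.1 ∈ twoSided β) {a n : ℕ} (han : a + m ≤ n)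
    {g : twoSided β → ℝ} (hg0 : ∀ x, 0 ≤ g x)
    (hg : ∀ x y : twoSided β, (∀ i ∉ Finset.Ico (a : ℤ) (a + m), x.1 i = y.1 i) → g x = g y) :
    ∑ y ∈ words β n, (shift (a : ℤ) ⁻¹' cylinder m u).indicator
        (fun y => Real.exp (bsum φ (Finset.Ico 0 (n : ℤ)) y) * g y) y ≤
      Real.exp (bsum φ (Finset.Ico 0 (m : ℤ)) u - bsum φ (Finset.Ico 0 (m : ℤ)) v + 3 * bdry o m) *
      ∑ y ∈ words β n, (shift (a : ℤ) ⁻¹' cylinder m v).indicator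
        (fun y => Real.exp (bsum φ (Finset.Ico 0 (n : ℤ)) y) * g y) y := by
  classical
  set D := bsum φ (Finset.Ico 0 (m : ℤ)) u - bsum φ (Finset.Ico 0 (m : ℤ)) v + 3 * bdry o m with hD
  have hex : ∀ y : twoSided β, shift (a : ℤ) y ∈ cylinder m u → ∃ z : twoSided β,
      ∀ i, z.1 i = if i ∈ Finset.Ico (a : ℤ) (a + m) then v.1 (i - a) else y.1 i := by
    intro y hy
    refine ⟨shift (-a : ℤ) ⟨_, hrep _ hy⟩, fun i => ?_⟩
    simp only [shift_apply, patch, Finset.mem_Ico, neg_add_cancel_right, sub_eq_add_neg]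
    congr 1
    simp only [eq_iff_iff]
    omega
  choose! Ψ hΨ using hex
  have hΨoff : ∀ y : twoSided β, shift (a : ℤ) y ∈ cylinder m u →
      ∀ i ∉ Finset.Ico (a : ℤ) (a + m), y.1 i = (Ψ y).1 i := fun y hy i hi => by
    rw [hΨ y hy, if_neg hi]
  have hΨcyl : ∀ y : twoSided β, shift (a : ℤ) y ∈ cylinder m u →
      shift (a : ℤ) (Ψ y) ∈ cylinder m v := fun y hy i hi => by
    rw [shift_apply, hΨ y hy, if_pos (Finset.mem_Ico.2 (by omega)), add_sub_cancel_right]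
  have hsum : ∀ y : twoSided β, shift (a : ℤ) y ∈ cylinder m u →
      bsum φ (Finset.Ico 0 (n : ℤ)) y ≤ D + bsum φ (Finset.Ico 0 (n : ℤ)) (Ψ y) := by
    intro y hy
    have hsub : Finset.Ico (a : ℤ) (a + m) ⊆ Finset.Ico 0 (n : ℤ) := fun i hi => by
      simp only [Finset.mem_Ico] at hi ⊢; omega
    have hsplit : ∀ z : twoSided β, bsum φ (Finset.Ico 0 (n : ℤ)) z =
        bsum φ (Finset.Ico 0 (n : ℤ) \ Finset.Ico (a : ℤ) (a + m)) z
          + bsum φ (Finset.Ico 0 (m : ℤ)) (shift a z) := by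
      intro z
      rw [bsum_shift, zero_add, add_comm (m : ℤ)]
      exact (Finset.sum_sdiff hsub).symm
    have hin : ∀ z w : twoSided β, z ∈ cylinder m w →
        |bsum φ (Finset.Ico 0 (m : ℤ)) z - bsum φ (Finset.Ico 0 (m : ℤ)) w| ≤ bdry o m :=
      fun z w hz => ho.abs_bsum_sub_le_of_eq_on (a := 0) (by simp)
        (by simpa using mem_cylinder_iff.1 hz)
    -- The three boundary terms in `D`: the block of `y` against `u`, the block of `Ψ y` against
    -- `v`, and the sites outside the block.
    have h1 := (abs_le.1 (hin _ _ hy)).2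
    have h2 := (abs_le.1 (hin _ _ (hΨcyl y hy))).1
    have h3 := (abs_le.1 (ho.abs_bsum_sub_le_of_eq_off (a := a) (N := m)
      (J := Finset.Ico 0 (n : ℤ) \ Finset.Ico (a : ℤ) (a + m))
      (fun j hj => (Finset.mem_sdiff.1 hj).2) (hΨoff y hy))).2
    rw [hsplit y, hsplit (Ψ y)]
    linarith
  simp only [indicator, mem_preimage]
  rw [← Finset.sum_filter, ← Finset.sum_filter, Finset.mul_sum]
  have hinj : Set.InjOn Ψ ((words β n).filter fun y => shift (a : ℤ) y ∈ cylinder m u) := by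
    intro y hy z hz hyz
    simp only [Finset.coe_filter, Set.mem_ofPred_eq] at hy hz
    refine ext_coord fun i => ?_
    by_cases hi : i ∈ Finset.Ico (a : ℤ) (a + m)
    · have h1 := mem_cylinder_iff.1 hy.2 (i - a) (by simp only [Finset.mem_Ico] at hi ⊢; omega)
      have h2 := mem_cylinder_iff.1 hz.2 (i - a) (by simp only [Finset.mem_Ico] at hi ⊢; omega)
      simp only [shift_apply, sub_add_cancel] at h1 h2
      rw [h1, h2]
    · rw [hΨoff y hy.2 i hi, hyz, ← hΨoff z hz.2 i hi]
  calc _ ≤ ∑ y ∈ (words β n).filter fun y => shift (a : ℤ) y ∈ cylinder m u,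
        Real.exp D * (Real.exp (bsum φ (Finset.Ico 0 (n : ℤ)) (Ψ y)) * g (Ψ y)) := by
        refine Finset.sum_le_sum fun y hy => ?_
        have hy := (Finset.mem_filter.1 hy).2
        rw [← mul_assoc, ← Real.exp_add, hg y (Ψ y) (hΨoff y hy)]
        exact mul_le_mul_of_nonneg_right (Real.exp_le_exp.2 (hsum y hy)) (hg0 _)
    _ = ∑ z ∈ ((words β n).filter fun y => shift (a : ℤ) y ∈ cylinder m u).image Ψ,
        Real.exp D * (Real.exp (bsum φ (Finset.Ico 0 (n : ℤ)) z) * g z) := by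
        rw [Finset.sum_image hinj]
    _ ≤ _ := by
        refine Finset.sum_le_sum_of_subset_of_nonneg (fun z hz => ?_) fun z _ _ =>
          mul_nonneg (Real.exp_pos _).le (mul_nonneg (Real.exp_pos _).le (hg0 z))
        obtain ⟨y, hy, rfl⟩ := Finset.mem_image.1 hz
        obtain ⟨hyw, hyc⟩ := Finset.mem_filter.1 hy
        refine Finset.mem_filter.2 ⟨mem_words.2 fun i hi => ?_, hΨcyl y hyc⟩
        rw [← hΨoff y hyc i fun h => hi (by simp only [Finset.mem_Ico] at h ⊢; omega)]
        exact mem_words.1 hyw i hi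

/-- Rewarding `u` by `1 + η` and penalizing `v` by `1 - η e^D` in consecutive blocks does not
increase the partition function. -/
theorem OscBound.sum_prod_replace_le (ho : OscBound φ o) {m : ℕ} {u v : twoSided β}
    (hrep : ∀ x ∈ cylinder m u, patch 0 m v.1 x.1 ∈ twoSided β) {η D : ℝ} (hη : 0 < η)
    (hD : D = bsum φ (Finset.Ico 0 (m : ℤ)) u - bsum φ (Finset.Ico 0 (m : ℤ)) v + 3 * bdry o m)
    (hηD : η * Real.exp D < 1) (n B : ℕ) (hB : B * m ≤ n) :
    ∑ y ∈ words β n, Real.exp (bsum φ (Finset.Ico 0 (n : ℤ)) y) * ∏ b ∈ Finset.range B,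
      (1 + (cylinder m u).indicator (fun _ => η) (shift (b * m : ℕ) y)
        - (cylinder m v).indicator (fun _ => η * Real.exp D) (shift (b * m : ℕ) y)) ≤
      windowZ φ n := by
  classical
  set h : twoSided β → ℝ := fun y => 1 + (cylinder m u).indicator (fun _ => η) y
        - (cylinder m v).indicator (fun _ => η * Real.exp D) y with hh
  have hh0 : ∀ y, 0 ≤ h y := fun y => by
    simp only [hh, indicator]
    split_ifs <;> linarith
  induction B with
  | zero => simp [windowZ]
  | succ B ih =>
    refine le_trans ?_ (ih (by nlinarith))
    set g : twoSided β → ℝ := fun y => ∏ b ∈ Finset.range B, h (shift (b * m : ℕ) y) with hg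
    -- The factors of the earlier blocks do not see the block being replaced, so they may serve as
    -- the weight `g`. The replacement bound then says that the gain `η` on `u` is at most the loss
    -- `η e^D` on `v`.
    have hrepl := ho.sum_replace_le hrep (a := B * m) (n := n) (by linarith) (g := g)
      (fun x => Finset.prod_nonneg fun b _ => hh0 _) (fun x y hxy => by
        refine Finset.prod_congr rfl fun b hb => ?_
        have hbB : b * m + m ≤ B * m := by
          have := Nat.mul_le_mul_right m (Finset.mem_range.1 hb)
          linarith
        have hiff : ∀ w : twoSided β, shift (b * m : ℕ) x ∈ cylinder m w ↔
            shift (b * m : ℕ) y ∈ cylinder m w := fun w => forall₂_congr fun i hi => by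
          rw [shift_apply, shift_apply, hxy _ (by rw [Finset.mem_Ico]; omega)]
        simp only [hh, indicator, hiff])
    rw [← hD] at hrepl
    have hstep : ∀ y, Real.exp (bsum φ (Finset.Ico 0 (n : ℤ)) y) *
        ∏ b ∈ Finset.range (B + 1), h (shift (b * m : ℕ) y) =
        Real.exp (bsum φ (Finset.Ico 0 (n : ℤ)) y) * g y
        + η * (shift ((B * m : ℕ) : ℤ) ⁻¹' cylinder m u).indicator
            (fun y => Real.exp (bsum φ (Finset.Ico 0 (n : ℤ)) y) * g y) y
        - η * Real.exp D * (shift ((B * m : ℕ) : ℤ) ⁻¹' cylinder m v).indicator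
            (fun y => Real.exp (bsum φ (Finset.Ico 0 (n : ℤ)) y) * g y) y := by
      intro y
      rw [Finset.prod_range_succ]
      simp only [hh, indicator, mem_preimage, hg]
      split_ifs <;> ring
    change ∑ y ∈ words β n, Real.exp (bsum φ (Finset.Ico 0 (n : ℤ)) y) *
        ∏ b ∈ Finset.range (B + 1), h (shift (b * m : ℕ) y) ≤
      ∑ y ∈ words β n, Real.exp (bsum φ (Finset.Ico 0 (n : ℤ)) y) * g y
    simp only [hstep]
    rw [Finset.sum_sub_distrib, Finset.sum_add_distrib, ← Finset.mul_sum, ← Finset.mul_sum]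
    have := mul_le_mul_of_nonneg_left hrepl hη.le
    linarith

/-- If the word of `u` may be replaced by that of `v` in every context, then an equilibrium measure
gives the cylinder of `v` at least the mass of that of `u`, up to the Gibbs factor. -/
theorem IsEquilibrium.measureReal_cylinder_le (hν : IsEquilibrium φ ν) (ho : OscBound φ o) {m : ℕ}
    (hm : 0 < m) {u v : twoSided β} (huv : u.1 0 ≠ v.1 0)
    (hrep : ∀ x ∈ cylinder m u, patch 0 m v.1 x.1 ∈ twoSided β) :
    ν.real (cylinder m u) ≤ Real.exp (bsum φ (Finset.Ico 0 (m : ℤ)) u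
      - bsum φ (Finset.Ico 0 (m : ℤ)) v + 3 * bdry o m) * ν.real (cylinder m v) := by
  classical
  have hinv := hν.1
  have := hinv.1
  set D := bsum φ (Finset.Ico 0 (m : ℤ)) u - bsum φ (Finset.Ico 0 (m : ℤ)) v + 3 * bdry o m with hD
  have hdisj : ∀ y, y ∈ cylinder m u → y ∉ cylinder m v := fun y h1 h2 =>
    huv ((h1 0 hm).symm.trans (h2 0 hm))
  have hmR : (0 : ℝ) < m := by exact_mod_cast hm
  have key : ∀ η : ℝ, 0 < η → η * Real.exp D < 1 →
      Real.log (1 + η) * ν.real (cylinder m u)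
        + Real.log (1 - η * Real.exp D) * ν.real (cylinder m v) ≤ 0 := by
    intro η hη hηD
    -- Chosen so that `e^w` is exactly the block factor of `OscBound.sum_prod_replace_le`.
    set w : twoSided β → ℝ := fun y => (cylinder m u).indicator (fun _ => Real.log (1 + η)) y
        + (cylinder m v).indicator (fun _ => Real.log (1 - η * Real.exp D)) y with hw
    have hwi : Integrable w ν :=
      ((integrable_const _).indicator (measurableSet_cylinder m u)).add
        ((integrable_const _).indicator (measurableSet_cylinder m v))
    have hwint : ∫ y, w y ∂ν = Real.log (1 + η) * ν.real (cylinder m u)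
        + Real.log (1 - η * Real.exp D) * ν.real (cylinder m v) := by
      rw [hw, integral_add ((integrable_const _).indicator (measurableSet_cylinder m u))
        ((integrable_const _).indicator (measurableSet_cylinder m v)),
        integral_indicator_const _ (measurableSet_cylinder m u),
        integral_indicator_const _ (measurableSet_cylinder m v), smul_eq_mul, smul_eq_mul]
      ring
    have hwexp : ∀ y, Real.exp (w y) = 1 + (cylinder m u).indicator (fun _ => η) y
        - (cylinder m v).indicator (fun _ => η * Real.exp D) y := by
      intro y
      by_cases h1 : y ∈ cylinder m u
      · simp only [hw, indicator_of_mem h1, indicator_of_notMem (hdisj y h1)]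
        rw [add_zero, Real.exp_log (by linarith)]; ring
      · by_cases h2 : y ∈ cylinder m v
        · simp only [hw, indicator_of_mem h2, indicator_of_notMem h1]
          rw [zero_add, Real.exp_log (by linarith)]; ring
        · simp [hw, indicator_of_notMem h1, indicator_of_notMem h2]
    rw [← hwint]
    refine le_of_forall_pos_le_add fun ε hε => ?_
    -- The error `ε / (4 * m)` per site occurs twice and `n ≤ 2 * B * m`, so it totals at most `ε`
    -- per block.
    have hε4 : 0 < ε / (4 * m) := by positivity
    obtain ⟨n, ⟨hn, hZ⟩, hlarge⟩ := (((hν.frequently_integral_le ho hε4).and_eventually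
      (ho.log_windowZ_le_eventually hε4)).and_eventually (eventually_ge_atTop m)).exists
    set B := n / m with hBdef
    have hBm : B * m ≤ n := Nat.div_mul_le_self n m
    have hB1 : 0 < B := Nat.div_pos hlarge hm
    have hn2 : (n : ℝ) ≤ 2 * (B * m) := by
      have h1 := Nat.lt_div_mul_add (a := n) hm
      rw [← hBdef] at h1
      have h2 : m ≤ B * m := Nat.le_mul_of_pos_left m hB1
      have : n ≤ 2 * (B * m) := by omega
      exact_mod_cast this
    have h1 := hn fun y => ∑ b ∈ Finset.range B, w (shift (b * m : ℕ) y)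
    have h2 : ∫ x, ∑ b ∈ Finset.range B, w (shift (b * m : ℕ) (trunc (Finset.Ico 0 (n : ℤ)) x)) ∂ν
        = B * ∫ y, w y ∂ν := by
      have e1 : ∀ x, ∑ b ∈ Finset.range B, w (shift (b * m : ℕ) (trunc (Finset.Ico 0 (n : ℤ)) x)) =
          ∑ b ∈ Finset.range B, w (shift (b * m : ℕ) x) := by
        refine fun x => Finset.sum_congr rfl fun b hb => ?_
        have hbB : b * m + m ≤ B * m := by
          have := Nat.mul_le_mul_right m (Finset.mem_range.1 hb)
          linarith
        have hiff : ∀ z : twoSided β, shift (b * m : ℕ) (trunc (Finset.Ico 0 (n : ℤ)) x) ∈ cylinder m z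
            ↔ shift (b * m : ℕ) x ∈ cylinder m z := fun z => forall₂_congr fun i hi => by
          rw [shift_apply, shift_apply, trunc_apply_of_mem _ (by rw [Finset.mem_Ico]; omega)]
        simp only [hw, indicator, hiff]
      simp only [e1]
      have hwi' : ∀ j : ℕ, Integrable (fun x => w (shift j x)) ν := fun j =>
        (hinv.measurePreserving j).integrable_comp_of_integrable hwi
      rw [integral_finsetSum _ fun b _ => hwi' (b * m)]
      have : ∀ j : ℕ, ∫ x, w (shift j x) ∂ν = ∫ x, w x ∂ν := by
        intro j
        have h := hinv.measurePreserving j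
        conv_rhs => rw [← h.map_eq]
        rw [integral_map h.aemeasurable (by rw [h.map_eq]; exact hwi.aestronglyMeasurable)]
      simp only [this]
      simp
    have h3 : ∑ y ∈ words β n, Real.exp (bsum φ (Finset.Ico 0 (n : ℤ)) y
        + ∑ b ∈ Finset.range B, w (shift (b * m : ℕ) y)) ≤ windowZ φ n := by
      have := ho.sum_prod_replace_le hrep hη hD hηD n B hBm
      simp only [← hwexp] at this
      simpa only [Real.exp_add, Real.exp_sum] using this
    have h4 := Real.log_le_log
      (Finset.sum_pos (fun _ _ => Real.exp_pos _) ⟨0, zero_mem_words n⟩) h3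
    rw [h2] at h1
    have hBR : (0 : ℝ) < B := by exact_mod_cast hB1
    have e2 : ε / (4 * m) * (2 * (B * m)) = ε / 2 * B := by field_simp; ring
    have h5 := mul_le_mul_of_nonneg_left hn2 hε4.le
    rw [e2] at h5
    have h6 : B * ∫ y, w y ∂ν ≤ B * ε := by linarith
    rw [zero_add]
    exact le_of_mul_le_mul_left h6 hBR
  -- To first order in `η`, `key` is the claim; bounding the logarithms by `1 - 1/t ≤ log t` and
  -- letting `η → 0` removes the corrections.
  have hlim : Tendsto (fun η : ℝ => (1 - η * Real.exp D) * ν.real (cylinder m u)) (𝓝[>] 0)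
      (𝓝 (ν.real (cylinder m u))) := by
    have : Continuous fun η : ℝ => (1 - η * Real.exp D) * ν.real (cylinder m u) := by fun_prop
    simpa using (this.tendsto 0).mono_left nhdsWithin_le_nhds
  have hlim' : Tendsto (fun η : ℝ => (1 + η) * (Real.exp D * ν.real (cylinder m v))) (𝓝[>] 0)
      (𝓝 (Real.exp D * ν.real (cylinder m v))) := by
    have : Continuous fun η : ℝ => (1 + η) * (Real.exp D * ν.real (cylinder m v)) := by fun_prop
    simpa using (this.tendsto 0).mono_left nhdsWithin_le_nhds
  refine le_of_tendsto_of_tendsto hlim hlim' ?_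
  filter_upwards [Ioo_mem_nhdsGT (inv_pos.2 (Real.exp_pos D))] with η hη
  have hηD : η * Real.exp D < 1 := by
    have := mul_lt_mul_of_pos_right hη.2 (Real.exp_pos D)
    rwa [inv_mul_cancel₀ (Real.exp_pos D).ne'] at this
  have h1 := key η hη.1 hηD
  have h2 := Real.one_sub_inv_le_log_of_pos (x := 1 + η) (by linarith [hη.1])
  have h3 := Real.one_sub_inv_le_log_of_pos (x := 1 - η * Real.exp D) (by linarith)
  have hp1 : 0 < 1 + η := by linarith [hη.1]
  have hp2 : 0 < 1 - η * Real.exp D := by linarith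
  have e1 : 1 - (1 + η)⁻¹ = η / (1 + η) := by field_simp; ring
  have e2 : 1 - (1 - η * Real.exp D)⁻¹ = -(η * Real.exp D / (1 - η * Real.exp D)) := by
    field_simp; ring
  rw [e1] at h2
  rw [e2] at h3
  have hu : 0 ≤ ν.real (cylinder m u) := measureReal_nonneg
  have hv : 0 ≤ ν.real (cylinder m v) := measureReal_nonneg
  have h4 := mul_le_mul_of_nonneg_right h2 hu
  have h5 := mul_le_mul_of_nonneg_right h3 hv
  have h6 : η / (1 + η) * ν.real (cylinder m u) ≤
      η * Real.exp D / (1 - η * Real.exp D) * ν.real (cylinder m v) := by linarith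
  rw [div_mul_eq_mul_div, div_mul_eq_mul_div, div_le_div_iff₀ hp1 hp2] at h6
  have h7 : η * ((1 - η * Real.exp D) * ν.real (cylinder m u)) ≤
      η * ((1 + η) * (Real.exp D * ν.real (cylinder m v))) := by linarith
  exact le_of_mul_le_mul_left h7 hη.1

end Replacement

/-! ### Upper and lower bounds for the measures of cylinders. -/

section CylinderBounds

variable {β : ℝ} [hβ : Fact (1 < β)] {φ : C(twoSided β, ℝ)} {o : ℤ → ℝ}
  {ν : Measure (twoSided β)}

theorem maxZeroRun_mono (β : ℝ) : Monotone (maxZeroRun β) := fun _ _ h =>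
  Finset.sup_mono (Finset.range_mono (Nat.succ_le_succ h))

/-- The leading zero and the `q` padding zeros cost at most `C` each; the rest is a translated copy
of the word of `y`. -/
theorem OscBound.bsum_insertWord_ge (ho : OscBound φ o) {C : ℝ} (hC : ∀ x, |φ x| ≤ C) (n q : ℕ)
    (y : twoSided β) : bsum φ (Finset.Ico 0 (n : ℤ)) y - bdry o n - (q + 1) * C ≤
      bsum φ (Finset.Ico 0 ((n + q + 1 : ℕ) : ℤ)) (insertWord n y) := by
  rw [bsum_Ico_add φ (b := 1) (c := ((n + q + 1 : ℕ) : ℤ)) (by omega) (by push_cast; omega),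
    bsum_Ico_add φ (a := 1) (b := n + 1) (c := ((n + q + 1 : ℕ) : ℤ)) (by omega)
      (by push_cast; omega)]
  have h1 := abs_le.1 (abs_bsum_le hC (Finset.Ico 0 1) (insertWord n y))
  have h2 := abs_le.1 (abs_bsum_le hC (Finset.Ico (n + 1 : ℤ) (n + q + 1 : ℕ)) (insertWord n y))
  have e1 : ((Finset.Ico (n + 1 : ℤ) (n + q + 1 : ℕ)).card : ℝ) = q := by
    rw [Int.card_Ico]
    congr 1
    push_cast; omega
  rw [e1] at h2
  have e2 : ((Finset.Ico (0 : ℤ) 1).card : ℝ) = 1 := by simp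
  rw [e2] at h1
  have h3 := ho.abs_bsum_sub_le_of_eq_on (a := 0) (N := n) (J := Finset.Ico 0 (n : ℤ)) (by simp)
    (x := y) (y := shift 1 (insertWord n y)) fun i hi => by
      rw [zero_add, Finset.mem_Ico] at hi
      rw [shift_apply, insertWord_apply, if_pos (by omega), add_sub_cancel_right]
  rw [bsum_shift, zero_add] at h3
  have := (abs_le.1 h3).2
  linarith [h1.1, h2.1]

/-- With the weight of `y` kept on the left, the inequality can be summed over `u` for a lower bound
or over `y` for an upper bound. -/
theorem IsEquilibrium.measureReal_cylinder_le_insertWord (hν : IsEquilibrium φ ν)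
    (ho : OscBound φ o) {C : ℝ} (hC : ∀ x, |φ x| ≤ C) {n q : ℕ} (hq : maxZeroRun β n < q)
    {u : twoSided β} (hu : u.1 0 ≠ 0) (y : twoSided β) :
    ν.real (cylinder (n + q + 1) u) * Real.exp (bsum φ (Finset.Ico 0 (n : ℤ)) y) ≤
      Real.exp (bsum φ (Finset.Ico 0 ((n + q + 1 : ℕ) : ℤ)) u
        + (bdry o n + 3 * bdry o (n + q + 1) + (q + 1) * C)) *
      ν.real (cylinder (n + q + 1) (insertWord n y)) := by
  have h0 : (insertWord n y).1 0 = 0 := by simp [insertWord_apply]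
  have h1 := hν.measureReal_cylinder_le ho (m := n + q + 1) (u := u) (v := insertWord n y)
    (Nat.succ_pos _) (by rwa [h0]) fun x hx => patch_insertWord_mem (fun l hl => by
      obtain ⟨i, hi, hpos⟩ := exists_digit_pos_of_maxZeroRun β hl
      exact ⟨i, by omega, hpos⟩) y x (by
        have := hx 0 (Nat.succ_pos _)
        simp only [Nat.cast_zero] at this
        rwa [this])
  have h2 := ho.bsum_insertWord_ge hC n q y
  calc _ ≤ _ := mul_le_mul_of_nonneg_right h1 (Real.exp_pos _).le
    _ = Real.exp (bsum φ (Finset.Ico 0 ((n + q + 1 : ℕ) : ℤ)) u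
          - bsum φ (Finset.Ico 0 ((n + q + 1 : ℕ) : ℤ)) (insertWord n y) + 3 * bdry o (n + q + 1)
          + bsum φ (Finset.Ico 0 (n : ℤ)) y) *
        ν.real (cylinder (n + q + 1) (insertWord n y)) := by
        rw [Real.exp_add _ (bsum φ (Finset.Ico 0 (n : ℤ)) y)]; ring
    _ ≤ _ := by
        refine mul_le_mul_of_nonneg_right (Real.exp_le_exp.2 ?_) measureReal_nonneg
        linarith

/-- Sum over all words `u` with nonzero first letter: the left sides cover `{x_0 ≠ 0}`, and the
right sides add up to at most the partition function. -/
theorem IsEquilibrium.measureReal_cylinder_ge (hν : IsEquilibrium φ ν)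
    (ho : OscBound φ o) {C : ℝ} (hC : ∀ x, |φ x| ≤ C) {n q : ℕ} (hq : maxZeroRun β n < q)
    (x : twoSided β) :
    ν.real {x | x.1 0 ≠ 0} * Real.exp (bsum φ (Finset.Ico 0 (n : ℤ)) x) ≤
      windowZ φ (n + q + 1) * Real.exp (bdry o n + 3 * bdry o (n + q + 1) + (q + 1) * C) *
        ν.real (cylinder n x) := by
  classical
  have := hν.1.1
  set m := n + q + 1 with hm
  have hcyl : ν.real (cylinder m (insertWord n x)) ≤ ν.real (cylinder n x) := by
    rw [← hν.1.measureReal_preimage 1 (measurableSet_cylinder n x)]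
    refine measureReal_mono fun y hy i hi => ?_
    have := hy (i + 1) (by omega)
    rw [insertWord_apply, if_pos (by push_cast; omega)] at this
    simpa using this
  have hcov : {x : twoSided β | x.1 0 ≠ 0} ⊆
      ⋃ u ∈ (words β m).filter fun u => u.1 0 ≠ 0, cylinder m u := by
    intro y hy
    simp only [mem_iUnion]
    refine ⟨trunc (Finset.Ico 0 (m : ℤ)) y, Finset.mem_filter.2 ⟨trunc_mem_words m y, ?_⟩, ?_⟩
    · rw [trunc_apply_of_mem _ (by rw [Finset.mem_Ico]; omega)]
      exact hy
    · exact mem_cylinder_iff.2 fun i hi => (trunc_apply_of_mem y hi).symm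
  calc _ ≤ (∑ u ∈ (words β m).filter fun u => u.1 0 ≠ 0, ν.real (cylinder m u)) *
        Real.exp (bsum φ (Finset.Ico 0 (n : ℤ)) x) :=
        mul_le_mul_of_nonneg_right ((measureReal_mono hcov (measure_ne_top _ _)).trans
          (measureReal_biUnion_finset_le _ _)) (Real.exp_pos _).le
    _ ≤ ∑ u ∈ (words β m).filter fun u => u.1 0 ≠ 0,
        Real.exp (bsum φ (Finset.Ico 0 (m : ℤ)) u) *
          (Real.exp (bdry o n + 3 * bdry o m + (q + 1) * C) * ν.real (cylinder n x)) := by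
        rw [Finset.sum_mul]
        refine Finset.sum_le_sum fun u hu => ?_
        refine (hν.measureReal_cylinder_le_insertWord ho hC hq (Finset.mem_filter.1 hu).2 x).trans ?_
        rw [Real.exp_add, mul_assoc]
        gcongr
    _ ≤ _ := by
        rw [windowZ, Finset.sum_mul, Finset.sum_mul]
        refine (Finset.sum_le_sum_of_subset_of_nonneg (Finset.filter_subset _ _) fun _ _ _ => ?_).trans
          (le_of_eq (Finset.sum_congr rfl fun _ _ => by ring))
        positivity

/-- Sum over `y`: the cylinders of the inserted words are disjoint, so their total measure is at
most 1. -/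
theorem IsEquilibrium.measureReal_cylinder_mul_windowZ_le (hν : IsEquilibrium φ ν)
    (ho : OscBound φ o) {C : ℝ} (hC : ∀ x, |φ x| ≤ C) {n q : ℕ} (hq : maxZeroRun β n < q)
    {u : twoSided β} (hu : u.1 0 ≠ 0) :
    ν.real (cylinder (n + q + 1) u) * windowZ φ n ≤
      Real.exp (bsum φ (Finset.Ico 0 ((n + q + 1 : ℕ) : ℤ)) u
        + (bdry o n + 3 * bdry o (n + q + 1) + (q + 1) * C)) := by
  classical
  have := hν.1.1
  have hdisj : (words β n : Set (twoSided β)).PairwiseDisjoint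
      fun y => cylinder (n + q + 1) (insertWord n y) := by
    intro y hy z hz hyz
    refine Set.disjoint_left.2 fun w h1 h2 => hyz (eq_of_mem_words hy hz fun i hi => ?_)
    rw [Finset.mem_Ico] at hi
    have e1 := mem_cylinder_iff.1 h1 (i + 1) (by rw [Finset.mem_Ico]; push_cast; omega)
    have e2 := mem_cylinder_iff.1 h2 (i + 1) (by rw [Finset.mem_Ico]; push_cast; omega)
    rw [insertWord_apply, if_pos (by omega), add_sub_cancel_right] at e1 e2
    exact e1.symm.trans e2
  have hone : ∑ y ∈ words β n, ν.real (cylinder (n + q + 1) (insertWord n y)) ≤ 1 := by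
    rw [← measureReal_biUnion_finset hdisj fun _ _ => measurableSet_cylinder _ _]
    exact measureReal_le_one
  rw [windowZ, Finset.mul_sum]
  refine (Finset.sum_le_sum fun y _ =>
    hν.measureReal_cylinder_le_insertWord ho hC hq hu y).trans ?_
  rw [← Finset.mul_sum]
  exact mul_le_of_le_one_right (Real.exp_pos _).le hone

/-- The points with a nonzero letter at `0`, followed by `i` zeros and then `x_0 ⋯ x_{n-1}`. -/
def delayed (n i : ℕ) (x : twoSided β) : Set (twoSided β) :=
  {z | z.1 0 ≠ 0 ∧ (∀ j : ℕ, j < i → z.1 (j + 1) = 0) ∧ shift ((i + 1 : ℕ) : ℤ) z ∈ cylinder n x}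

theorem mem_delayed_of_mem_cylinder {n i : ℕ} {x y z : twoSided β} (hz : z ∈ delayed n i x)
    (hy : y ∈ cylinder (n + i + 1) z) : y ∈ delayed n i x := by
  refine ⟨?_, fun j hj => ?_, fun j hj => ?_⟩
  · have := hy 0 (by omega)
    simp only [Nat.cast_zero] at this
    rw [this]; exact hz.1
  · have := hy (j + 1) (by omega)
    push_cast at this
    rw [this]; exact hz.2.1 j hj
  · have := hy (j + (i + 1)) (by omega)
    push_cast at this
    rw [← hz.2.2 j hj]
    simpa using this

theorem delayed_subset (n i : ℕ) (x : twoSided β) :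
    delayed n i x ⊆ ⋃ u ∈ ((words β (n + i + 1)).finite_toSet.inter_of_left (delayed n i x)).toFinset,
      cylinder (n + i + 1) u := by
  intro y hy
  have h1 : trunc (Finset.Ico 0 ((n + i + 1 : ℕ) : ℤ)) y ∈ cylinder (n + i + 1) y :=
    (trunc_mem_cylinder_iff le_rfl).2 (self_mem_cylinder _ _)
  simp only [mem_iUnion, Set.Finite.mem_toFinset]
  exact ⟨_, ⟨trunc_mem_words _ y, mem_delayed_of_mem_cylinder hy h1⟩, fun j hj => (h1 j hj).symm⟩

theorem card_delayed_words_le (n i : ℕ) (x : twoSided β) :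
    ((words β (n + i + 1)).finite_toSet.inter_of_left (delayed n i x)).toFinset.card ≤ ⌈β⌉₊ := by
  rw [← Fintype.card_fin ⌈β⌉₊, ← Finset.card_univ]
  refine Finset.card_le_card_of_injOn (fun u => u.1 0) (fun _ _ => Finset.mem_univ _) ?_
  intro u hu w hw h0
  simp only [Set.Finite.coe_toFinset] at hu hw
  refine eq_of_mem_words hu.1 hw.1 fun k hk => ?_
  rw [Finset.mem_Ico] at hk
  obtain ⟨k, rfl⟩ := Int.eq_ofNat_of_zero_le hk.1
  rcases Nat.eq_zero_or_pos k with rfl | hk0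
  · exact h0
  rcases lt_or_ge k (i + 1) with hki | hki
  · obtain ⟨j, rfl⟩ : ∃ j, k = j + 1 := ⟨k - 1, by omega⟩
    push_cast
    rw [hu.2.2.1 j (by omega), hw.2.2.1 j (by omega)]
  · obtain ⟨j, rfl⟩ := Nat.exists_eq_add_of_le' hki
    have h1 := hu.2.2.2 j (by omega)
    have h2 := hw.2.2.2 j (by omega)
    have := h1.trans h2.symm
    simpa only [shift_apply, ← Nat.cast_add] using this

theorem OscBound.bsum_delayed_le (ho : OscBound φ o) {C : ℝ} (hC : ∀ x, |φ x| ≤ C) {n i : ℕ}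
    {x u : twoSided β} (hu : u ∈ delayed n i x) :
    bsum φ (Finset.Ico 0 ((n + i + 1 : ℕ) : ℤ)) u ≤
      bsum φ (Finset.Ico 0 (n : ℤ)) x + i * φ 0 + (C + bdry o i + bdry o n) := by
  rw [bsum_Ico_add φ (b := 1) (by omega) (by push_cast; omega),
    bsum_Ico_add φ (a := 1) (b := i + 1) (by omega) (by push_cast; omega)]
  have h1 := abs_le.1 (abs_bsum_le hC (Finset.Ico 0 1) u)
  have e2 : ((Finset.Ico (0 : ℤ) 1).card : ℝ) = 1 := by simp
  rw [e2] at h1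
  have h2 := ho.abs_bsum_sub_le_of_eq_on (a := 0) (N := i) (J := Finset.Ico 0 (i : ℤ)) (by simp)
    (x := shift 1 u) (y := 0) fun k hk => by
      rw [zero_add, Finset.mem_Ico] at hk
      obtain ⟨k, rfl⟩ := Int.eq_ofNat_of_zero_le hk.1
      exact hu.2.1 k (by omega)
  rw [bsum_shift, zero_add, bsum_zero_point, Int.card_Ico, sub_zero, Int.toNat_natCast] at h2
  have h3 := ho.abs_bsum_sub_le_of_eq_on (a := 0) (N := n) (J := Finset.Ico 0 (n : ℤ)) (by simp)
    (x := shift ((i + 1 : ℕ) : ℤ) u) (y := x) (by simpa using mem_cylinder_iff.1 hu.2.2)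
  rw [bsum_shift, zero_add] at h3
  have e3 : (n : ℤ) + ((i + 1 : ℕ) : ℤ) = ((n + i + 1 : ℕ) : ℤ) := by push_cast; ring
  rw [e3] at h3
  push_cast at h3 ⊢
  linarith [h1.2, (abs_le.1 h2).2, (abs_le.1 h3).2]

/-- The error term in the upper bound for the measure of cylinders. -/
def upperError (φ : C(twoSided β, ℝ)) (o : ℤ → ℝ) (C : ℝ) (m : ℕ) : ℝ :=
  8 * bdry o m + (maxZeroRun β m + 3) * (C + |pressure φ|)

/-- This is where the sublinear growth of z̄ enters part (1). The second clause leaves room in a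
window of length `m` for the padding. -/
theorem OscBound.upperError_le_eventually {β : ℝ} {φ : C(twoSided β, ℝ)} {o : ℤ → ℝ} (ho : OscBound φ o) {C : ℝ} (hC0 : 0 ≤ C)
    (hz : Tendsto (fun n : ℕ => (maxZeroRun β n : ℝ) / n) atTop (𝓝 0)) {ε : ℝ} (hε : 0 < ε) :
    ∀ᶠ m : ℕ in atTop, upperError φ o C m ≤ ε * m ∧ maxZeroRun β m + 2 ≤ m := by
  set K := C + |pressure φ| + 1 with hK
  have hK0 : 0 < K := by positivity
  filter_upwards [bdry_le_eventually ho.nonneg ho.summable (ε := ε / 16) (by positivity),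
    hz.eventually_lt_const (u := min (ε / (4 * K)) (1 / 2)) (by positivity),
    (tendsto_natCast_atTop_atTop (R := ℝ)).eventually_ge_atTop (12 * K / ε),
    eventually_ge_atTop 4] with m h1 h2 h3 h4
  have hmR : (0 : ℝ) < m := by exact_mod_cast (by omega : 0 < m)
  rw [lt_min_iff, div_lt_iff₀ hmR, div_lt_iff₀ hmR] at h2
  rw [div_le_iff₀ hε] at h3
  constructor
  · have h5 : (maxZeroRun β m + 3 : ℝ) * (C + |pressure φ|) ≤ (maxZeroRun β m + 3) * K := by
      gcongr; linarith
    have h6 : (maxZeroRun β m : ℝ) * K ≤ ε / 4 * m := by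
      calc _ ≤ ε / (4 * K) * m * K := mul_le_mul_of_nonneg_right h2.1.le hK0.le
        _ = _ := by field_simp
    rw [upperError]
    linarith
  · have h5 : (2 * maxZeroRun β m : ℝ) < m := by linarith [h2.2]
    have h6 : 2 * maxZeroRun β m < m := by exact_mod_cast h5
    omega

/-- The `i` zeros contribute energy `i * φ 0` while the normalization charges the pressure for each
site, whence the decay in `i`. -/
theorem IsEquilibrium.measureReal_delayed_le (hν : IsEquilibrium φ ν) (ho : OscBound φ o) {C : ℝ}
    (hC : ∀ x, |φ x| ≤ C) {n i : ℕ} (hq : maxZeroRun β (n + i + 1) + 2 ≤ n + i + 1)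
    (x : twoSided β) : ν.real (delayed n i x) ≤
      ⌈β⌉₊ * Real.exp (bsum φ (Finset.Ico 0 (n : ℤ)) x - n * pressure φ
        - i * (pressure φ - φ 0) + upperError φ o C (n + i + 1)) := by
  have := hν.1.1
  obtain ⟨N, hN⟩ := Nat.exists_eq_add_of_le' hq
  set z := maxZeroRun β (n + i + 1) with hz
  have hmN : n + i + 1 = N + (z + 1) + 1 := by omega
  have hzN : maxZeroRun β N < z + 1 := Nat.lt_succ_of_le (maxZeroRun_mono β (by omega))
  refine (measureReal_mono (delayed_subset n i x) (measure_ne_top _ _)).trans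
    ((measureReal_biUnion_finset_le _ _).trans ?_)
  have hterm : ∀ u ∈ ((words β (n + i + 1)).finite_toSet.inter_of_left (delayed n i x)).toFinset,
      ν.real (cylinder (n + i + 1) u) ≤ Real.exp (bsum φ (Finset.Ico 0 (n : ℤ)) x - n * pressure φ
        - i * (pressure φ - φ 0) + upperError φ o C (n + i + 1)) := by
    intro u hu
    have hu := ((Set.Finite.mem_toFinset _).1 hu).2
    have h1 := hν.measureReal_cylinder_mul_windowZ_le ho hC hzN hu.1
    rw [← hmN, ← le_div_iff₀ (windowZ_pos φ N), ← Real.exp_log (windowZ_pos φ N), ← Real.exp_sub]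
      at h1
    refine h1.trans (Real.exp_le_exp.2 ?_)
    -- Boundary terms add up to `8 * bdry`: four from the replacement bound, two here, two from
    -- `mul_pressure_le`. The padding length `z + 1` gives `(z + 2) * C` in `h1`; one more `C` comes
    -- from the first letter.
    have h2 := ho.bsum_delayed_le hC hu
    have h3 := ho.mul_pressure_le N
    have hb := bdry_mono ho.nonneg ho.summable
    have hb1 := hb (show i ≤ n + i + 1 by omega)
    have hb2 := hb (show n ≤ n + i + 1 by omega)
    have hb3 := hb (show N ≤ n + i + 1 by omega)
    have hNR : (n : ℝ) + i + 1 = N + (z + 1) + 1 := by exact_mod_cast hmN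
    have hP := le_abs_self (pressure φ)
    have hP' : (z + 1 : ℝ) * pressure φ ≤ (z + 1) * |pressure φ| :=
      mul_le_mul_of_nonneg_left hP (by positivity)
    have hNP : (N : ℝ) * pressure φ = n * pressure φ + i * pressure φ - (z + 1) * pressure φ := by
      have : (N : ℝ) = n + i - (z + 1) := by linarith
      rw [this]; ring
    have hP0 := abs_nonneg (pressure φ)
    rw [upperError, ← hz]
    rw [Nat.cast_succ z]
    linarith
  refine (Finset.sum_le_card_nsmul _ _ _ hterm).trans ?_
  rw [nsmul_eq_mul]
  exact mul_le_mul_of_nonneg_right (Nat.cast_le.2 (card_delayed_words_le n i x)) (Real.exp_pos _).le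

/-- By invariance the word may be placed at `R`. Either the `R` preceding letters all vanish, or the
last nonzero one determines the delay. -/
theorem IsEquilibrium.measureReal_cylinder_le_sum_delayed (hν : IsEquilibrium φ ν)
    (n R : ℕ) (x : twoSided β) :
    ν.real (cylinder n x) ≤ ν.real (cylinder R 0) + ∑ i ∈ Finset.range R, ν.real (delayed n i x) := by
  classical
  have := hν.1.1
  have hm : ∀ i, MeasurableSet (delayed n i x) := by
    intro i
    have : delayed n i x = ⋃ u ∈ ((words β (n + i + 1)).finite_toSet.inter_of_left
        (delayed n i x)).toFinset, cylinder (n + i + 1) u := by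
      refine (delayed_subset n i x).antisymm (iUnion₂_subset fun u hu => ?_)
      exact fun y hy => mem_delayed_of_mem_cylinder ((Set.Finite.mem_toFinset _).1 hu).2 hy
    rw [this]
    exact Finset.measurableSet_biUnion _ fun u _ => measurableSet_cylinder _ _
  rw [← Finset.sum_range_reflect, ← hν.1.measureReal_preimage R (measurableSet_cylinder n x)]
  have hcov : shift (R : ℤ) ⁻¹' cylinder n x ⊆ cylinder R 0 ∪
      ⋃ j ∈ Finset.range R, shift (j : ℤ) ⁻¹' delayed n (R - 1 - j) x := by
    intro y hy
    by_cases h0 : y ∈ cylinder R 0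
    · exact Or.inl h0
    right
    simp only [cylinder, Set.mem_ofPred_eq] at h0
    push Not at h0
    obtain ⟨j, hj, hmax⟩ := Finset.exists_max_image
      ((Finset.range R).filter fun j : ℕ => y.1 j ≠ 0) id (by
        obtain ⟨i, hi, hne⟩ := h0
        exact ⟨i, Finset.mem_filter.2 ⟨Finset.mem_range.2 hi, hne⟩⟩)
    obtain ⟨hjR, hj0⟩ := Finset.mem_filter.1 hj
    rw [Finset.mem_range] at hjR
    simp only [mem_iUnion]
    refine ⟨j, Finset.mem_range.2 hjR, ?_, fun k hk => ?_, fun k hk => ?_⟩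
    · simpa using hj0
    · by_contra hne
      have := hmax (k + 1 + j) (Finset.mem_filter.2 ⟨Finset.mem_range.2 (by omega), by
        rw [shift_apply] at hne; push_cast; exact hne⟩)
      simp only [id] at this
      omega
    · rw [← hy k hk, shift_shift]
      rw [show (((R - 1 - j + 1 : ℕ) : ℤ) + j) = R by omega]
  refine (measureReal_mono hcov (measure_ne_top _ _)).trans ((measureReal_union_le _ _).trans
    (add_le_add le_rfl ((measureReal_biUnion_finset_le _ _).trans (le_of_eq ?_))))
  exact Finset.sum_congr rfl fun j _ => hν.1.measureReal_preimage j (hm _)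

theorem bsum_sub_const {β : ℝ} (φ : C(twoSided β, ℝ)) (c : ℝ) (m : ℕ) (x : twoSided β) :
    ∑ l ∈ Finset.range m, (φ - ContinuousMap.const _ c : C(twoSided β, ℝ)) (shift (l : ℤ) x) =
      bsum φ (Finset.Ico 0 (m : ℤ)) x - m * c := by
  rw [← bsum_range]
  simp [Finset.sum_sub_distrib]

theorem IsEquilibrium.log_cylinder_ge_eventually (hν : IsEquilibrium φ ν) (ho : OscBound φ o)
    (hz : Tendsto (fun n : ℕ => (maxZeroRun β n : ℝ) / n) atTop (𝓝 0)) {δ : ℝ} (hδ : 0 < δ) :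
    ∀ᶠ n : ℕ in atTop, ∀ x : twoSided β, 0 < ν.real (cylinder n x) ∧
      bsum φ (Finset.Ico 0 (n : ℤ)) x - n * pressure φ - δ * n ≤ Real.log (ν.real (cylinder n x)) := by
  set C := |φ 0| + ∑' k, o k with hCdef
  have hC : ∀ x, |φ x| ≤ C := ho.abs_apply_le
  have hC0 : 0 ≤ C := (abs_nonneg _).trans (hC 0)
  -- Of the twelve parts, two go to `log windowZ`, one and six to the boundary terms, one to the
  -- padding and one to `log α`.
  set ε := δ / 12 with hε
  have hε0 : 0 < ε := by positivity
  set α := ν.real {x | x.1 0 ≠ 0} with hα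
  have hα0 : 0 < α := hν.measureReal_ne_zero_pos ho
  have hmt : Tendsto (fun n => n + (maxZeroRun β n + 1) + 1) atTop atTop :=
    tendsto_atTop_mono (fun n => (by omega : n ≤ n + (maxZeroRun β n + 1) + 1)) tendsto_id
  filter_upwards [hmt.eventually (ho.log_windowZ_le_eventually hε0),
    hmt.eventually (bdry_le_eventually ho.nonneg ho.summable hε0),
    bdry_le_eventually ho.nonneg ho.summable hε0,
    ho.upperError_le_eventually hC0 hz hε0,
    (tendsto_natCast_atTop_atTop (R := ℝ)).eventually_ge_atTop (-Real.log α / ε),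
    eventually_gt_atTop 0] with n h1 h2 h3 h4 h5 hn x
  set q := maxZeroRun β n + 1 with hq
  have hge := hν.measureReal_cylinder_ge ho hC (n := n) (q := q) (by omega) x
  have hpos : 0 < ν.real (cylinder n x) := by
    refine measureReal_nonneg.lt_of_ne fun h0 => ?_
    rw [← h0, mul_zero] at hge
    exact absurd hge (not_le.2 (by positivity))
  refine ⟨hpos, ?_⟩
  have hl := Real.log_le_log (by positivity) hge
  rw [Real.log_mul hα0.ne' (Real.exp_pos _).ne', Real.log_exp,
    Real.log_mul (mul_pos (windowZ_pos φ _) (Real.exp_pos _)).ne' hpos.ne',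
    Real.log_mul (windowZ_pos φ _).ne' (Real.exp_pos _).ne', Real.log_exp] at hl
  rw [div_le_iff₀ hε0] at h5
  have hnR : (0 : ℝ) < n := by exact_mod_cast hn
  have hm2 : ((n + q + 1 : ℕ) : ℝ) ≤ 2 * n := by exact_mod_cast (by omega : n + q + 1 ≤ 2 * n)
  have h6 : bdry o (n + q + 1) ≤ ε * (2 * n) := h2.trans (mul_le_mul_of_nonneg_left hm2 hε0.le)
  have h7 : (q + 1 : ℝ) * (C + |pressure φ|) ≤ ε * n := by
    refine le_trans ?_ h4.1
    rw [upperError, hq]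
    push_cast
    have := bdry_nonneg ho.nonneg n
    have := abs_nonneg (pressure φ)
    linarith
  have hP := mul_le_mul_of_nonneg_left (le_abs_self (pressure φ)) (by positivity : (0 : ℝ) ≤ q + 1)
  have h8 : ((n + q + 1 : ℕ) : ℝ) * (pressure φ + ε) ≤
      n * pressure φ + (q + 1) * |pressure φ| + ε * (2 * n) := by
    have := mul_le_mul_of_nonneg_right hm2 hε0.le
    push_cast at this ⊢
    linarith
  have e : δ * (n : ℝ) = 12 * (ε * n) := by rw [hε]; ring
  have hεn : 0 < ε * n := by positivity
  rw [e]
  linarith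

theorem IsEquilibrium.log_cylinder_le_eventually (hν : IsEquilibrium φ ν) (ho : OscBound φ o)
    (hz : Tendsto (fun n : ℕ => (maxZeroRun β n : ℝ) / n) atTop (𝓝 0)) {δ : ℝ} (hδ : 0 < δ) :
    ∀ᶠ n : ℕ in atTop, ∀ x : twoSided β, 0 < ν.real (cylinder n x) →
      Real.log (ν.real (cylinder n x)) ≤
        bsum φ (Finset.Ico 0 (n : ℤ)) x - n * pressure φ + δ * n := by
  set C := |φ 0| + ∑' k, o k with hCdef
  have hC : ∀ x, |φ x| ≤ C := ho.abs_apply_le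
  have hC0 : 0 ≤ C := (abs_nonneg _).trans (hC 0)
  set γ := pressure φ - φ 0 with hγ
  have hγ0 : 0 < γ := sub_pos.2 ho.apply_zero_lt_pressure
  -- The error in a window of length `n + i + 1` also grows with `i`; `ε ≤ γ / 2` keeps a decay rate
  -- `γ / 2`, hence the ratio `r`.
  set ε := min (δ / 2) (γ / 2) with hε
  have hε0 : 0 < ε := by positivity
  have hεδ : ε ≤ δ / 2 := min_le_left _ _
  have hεγ : ε ≤ γ / 2 := min_le_right _ _
  set r := Real.exp (-(γ / 2)) with hr
  have hr1 : r < 1 := Real.exp_lt_one_iff.2 (by linarith)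
  have hr0 : 0 < r := Real.exp_pos _
  have hceil : (0 : ℝ) < ⌈β⌉₊ := by exact_mod_cast Nat.pos_of_ne_zero (NeZero.ne ⌈β⌉₊)
  set A := ⌈β⌉₊ * Real.exp ε * (1 - r)⁻¹ with hA
  have hA0 : 0 < A := by
    have : 0 < 1 - r := by linarith
    positivity
  obtain ⟨N, hN⟩ := eventually_atTop.1 (ho.upperError_le_eventually hC0 hz hε0)
  filter_upwards [eventually_ge_atTop N,
    (tendsto_natCast_atTop_atTop (R := ℝ)).eventually_ge_atTop (Real.log A / (δ / 2))]
    with n hn hlarge x hpos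
  rw [div_le_iff₀ (by positivity)] at hlarge
  set s := bsum φ (Finset.Ico 0 (n : ℤ)) x - n * pressure φ with hs
  have hdel : ∀ i, ν.real (delayed n i x) ≤ ⌈β⌉₊ * Real.exp ε * Real.exp (s + ε * n) * r ^ i := by
    intro i
    obtain ⟨h1, h2⟩ := hN (n + i + 1) (by omega)
    refine (hν.measureReal_delayed_le ho hC h2 x).trans ?_
    rw [mul_assoc, mul_assoc, ← Real.exp_nat_mul, ← Real.exp_add, ← Real.exp_add]
    refine mul_le_mul_of_nonneg_left (Real.exp_le_exp.2 ?_) hceil.le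
    have h3 := mul_le_mul_of_nonneg_left hεγ (Nat.cast_nonneg (α := ℝ) i)
    push_cast at h1
    linarith
  have hbound : ν.real (cylinder n x) ≤ A * Real.exp (s + ε * n) := by
    -- The geometric bound is uniform in `R`, so `R` can be chosen afterwards to make the all-zero
    -- term arbitrarily small.
    refine le_of_forall_pos_le_add fun η hη => ?_
    obtain ⟨R, hR⟩ := hν.exists_cylinder_zero_le ho hη
    have h1 := hν.measureReal_cylinder_le_sum_delayed n R x
    have h2 : ∑ i ∈ Finset.range R, ν.real (delayed n i x) ≤ A * Real.exp (s + ε * n) := by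
      refine (Finset.sum_le_sum fun i _ => hdel i).trans ?_
      rw [← Finset.mul_sum]
      have h3 : ∑ i ∈ Finset.range R, r ^ i ≤ (1 - r)⁻¹ := by
        rw [← tsum_geometric_of_lt_one hr0.le hr1]
        exact (summable_geometric_of_lt_one hr0.le hr1).sum_le_tsum _ fun i _ => by positivity
      calc _ ≤ ⌈β⌉₊ * Real.exp ε * Real.exp (s + ε * n) * (1 - r)⁻¹ :=
            mul_le_mul_of_nonneg_left h3 (by positivity)
        _ = _ := by rw [hA]; ring
    linarith
  have hl := Real.log_le_log hpos hbound
  rw [Real.log_mul hA0.ne' (Real.exp_pos _).ne', Real.log_exp] at hl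
  have := mul_le_mul_of_nonneg_right hεδ (Nat.cast_nonneg (α := ℝ) n)
  linarith

theorem IsEquilibrium.isWeakGibbs (hν : IsEquilibrium φ ν) (ho : OscBound φ o)
    (hz : Tendsto (fun n : ℕ => (maxZeroRun β n : ℝ) / n) atTop (𝓝 0)) :
    IsWeakGibbs (φ - ContinuousMap.const _ (pressure φ)) ν := by
  refine ⟨hν.1, fun δ hδ => ?_⟩
  obtain ⟨N, hN⟩ := eventually_atTop.1 (((hν.log_cylinder_ge_eventually ho hz hδ).and
    (hν.log_cylinder_le_eventually ho hz hδ)).and (eventually_gt_atTop 0))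
  refine ⟨N, fun m hm x => ?_⟩
  obtain ⟨⟨h1, h2⟩, hm0⟩ := hN m hm
  obtain ⟨hpos, h1⟩ := h1 x
  have hmR : (0 : ℝ) < m := by exact_mod_cast hm0
  refine ⟨hpos, ?_⟩
  rw [bsum_sub_const, ← mul_sub, abs_mul, abs_of_pos (by positivity), one_div, inv_mul_le_iff₀ hmR,
    abs_le]
  constructor <;> linarith [h2 x hpos]

/-- Compare the lengths `l` and `l + p` at a longest zero run of `c`: equal cylinders force `p * γ ≤
δ * (2 * l + p) + bdry o p`, whose right side is at most `p * γ / 2`. -/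
theorem OscBound.not_isWeakGibbs (ho : OscBound φ o)
    (hz : 0 < limsup (fun n : ℕ => (((maxZeroRun β n : ℝ) / n : ℝ) : EReal)) atTop) :
    ¬ IsWeakGibbs (φ - ContinuousMap.const _ (pressure φ)) ν := by
  rintro ⟨-, hgibbs⟩
  set γ := pressure φ - φ 0 with hγ
  have hγ0 : 0 < γ := sub_pos.2 ho.apply_zero_lt_pressure
  obtain ⟨ε, hε0, hε⟩ := EReal.lt_iff_exists_real_btwn.1 hz
  have hε0 : 0 < ε := EReal.coe_pos.1 hε0
  have hfreq := frequently_lt_of_lt_limsup (by isBoundedDefault) hε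
  -- Chosen so that `l ≤ p / ε` implies `δ * (2 * l + p) ≤ γ / 4 * p`.
  set δ := γ / (4 * (2 / ε + 1)) with hδ
  have hδ0 : 0 < δ := by positivity
  obtain ⟨N, hN⟩ := hgibbs δ hδ0
  obtain ⟨Q, hQ⟩ := eventually_atTop.1
    (bdry_le_eventually ho.nonneg ho.summable (ε := γ / 4) (by positivity))
  -- The threshold makes the run exceed `maxZeroRun β N + Q`: the first summand forces its prefix to
  -- have length at least `N`, the second makes `bdry o p ≤ γ / 4 * p`.
  obtain ⟨n, hn, hlarge⟩ := (hfreq.and_eventually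
    ((tendsto_natCast_atTop_atTop (R := ℝ)).eventually_gt_atTop
      (((maxZeroRun β N + Q : ℕ) : ℝ) / ε))).exists
  rw [div_lt_iff₀ hε0] at hlarge
  have hn := EReal.coe_lt_coe_iff.1 hn
  have hnR : (0 : ℝ) < n := by
    refine (Nat.cast_nonneg n).lt_of_ne fun h => ?_
    rw [← h, div_zero] at hn
    linarith
  rw [lt_div_iff₀ hnR] at hn
  obtain ⟨l, hl, hlz⟩ := Finset.exists_mem_eq_sup (Finset.range (n + 1)) ⟨0, by simp⟩ (zeroRun β)
  have hln : l ≤ n := Nat.lt_succ_iff.1 (Finset.mem_range.1 hl)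
  set p := zeroRun β l with hp
  have hpz : maxZeroRun β n = p := hlz
  rw [hpz] at hn
  have hpbig : maxZeroRun β N + Q < p := by
    have : ((maxZeroRun β N + Q : ℕ) : ℝ) < p := by linarith
    exact_mod_cast this
  have hlN : N ≤ l := by
    by_contra! h
    have : p ≤ maxZeroRun β N :=
      Finset.le_sup (f := zeroRun β) (Finset.mem_range.2 (by omega))
    omega
  have hl0 : 0 < l := by
    refine Nat.pos_of_ne_zero fun h => ?_
    have : p = 0 := by rw [hp, h]; simp [zeroRun]
    omega
  set x := digitPoint β with hx
  have hconv : ∀ m : ℕ, N ≤ m → 0 < m → |Real.log (ν.real (cylinder m x))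
      - (bsum φ (Finset.Ico 0 (m : ℤ)) x - m * pressure φ)| ≤ δ * m := by
    intro m hm hm0
    have h1 := (hN m hm x).2
    have hmR : (0 : ℝ) < m := by exact_mod_cast hm0
    rwa [bsum_sub_const, ← mul_sub, abs_mul, abs_of_pos (by positivity), one_div,
      inv_mul_le_iff₀ hmR, mul_comm (m : ℝ) δ] at h1
  have h1 := hconv l hlN hl0
  have h2 := hconv (l + p) (by omega) (by omega)
  rw [hx, cylinder_digitPoint, ← hx] at h2
  have h3 : bsum φ (Finset.Ico (l : ℤ) ((l + p : ℕ) : ℤ)) x ≤ p * φ 0 + bdry o p := by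
    have := ho.abs_bsum_sub_le_of_eq_on (a := 0) (N := p) (J := Finset.Ico 0 (p : ℤ)) (by simp)
      (x := shift l x) (y := 0) fun i hi => by
        rw [zero_add, Finset.mem_Ico] at hi
        obtain ⟨i, rfl⟩ := Int.eq_ofNat_of_zero_le hi.1
        refine Fin.ext ?_
        rw [shift_apply, add_comm, ← Nat.cast_add, hx, digitPoint_apply]
        exact digit_eq_zero_of_lt_zeroRun (by omega)
    rw [bsum_shift, bsum_zero_point, Int.card_Ico, sub_zero, Int.toNat_natCast, zero_add,
      add_comm (p : ℤ), ← Nat.cast_add] at this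
    linarith [(abs_le.1 this).2]
  rw [bsum_Ico_add φ (b := l) (c := ((l + p : ℕ) : ℤ)) (by omega) (by push_cast; omega)] at h2
  have h4 := (abs_le.1 h1).1
  have h5 := (abs_le.1 h2).2
  have h6 := hQ p (by omega)
  push_cast at h5 h3
  have hpR : (0 : ℝ) < p := by exact_mod_cast (by omega : 0 < p)
  have hlp : (l : ℝ) ≤ p / ε := by
    rw [le_div_iff₀ hε0]
    have : (l : ℝ) ≤ n := by exact_mod_cast hln
    nlinarith
  have h7 : δ * (2 * l + p) ≤ γ / 4 * p := by
    calc δ * (2 * l + p) ≤ δ * (2 * (p / ε) + p) := by gcongr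
      _ = γ / 4 * p := by rw [hδ]; field_simp
  have h8 : p * γ = p * pressure φ - p * φ 0 := by rw [hγ]; ring
  have h9 : 0 < γ * p := by positivity
  linarith

end CylinderBounds

end BetaShift

end

theorem theorem1 (β : ℝ) (hβ : 1 < β) (φ : C(BetaShift.twoSided β, ℝ))
    (hφ : BetaShift.BoundedTotalOsc φ) :
    (Tendsto (fun n : ℕ => (BetaShift.maxZeroRun β n : ℝ) / n) atTop (𝓝 0) →
      ∀ ν : Measure (BetaShift.twoSided β), BetaShift.IsEquilibrium φ ν →
        BetaShift.IsWeakGibbs (φ - ContinuousMap.const _ (BetaShift.pressure φ)) ν) ∧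
    (0 < limsup (fun n : ℕ => (((BetaShift.maxZeroRun β n : ℝ) / n : ℝ) : EReal)) atTop →
      ∀ ν : Measure (BetaShift.twoSided β), BetaShift.IsEquilibrium φ ν →
        ¬ BetaShift.IsWeakGibbs (φ - ContinuousMap.const _ (BetaShift.pressure φ)) ν) := by
  have : Fact (1 < β) := ⟨hβ⟩
  obtain ⟨o, ho⟩ := hφ.exists_oscBound
  exact ⟨fun hz ν hν => hν.isWeakGibbs ho hz, fun hz ν _ => ho.not_isWeakGibbs hz⟩
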